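/- Let $q$ be a prime power and $m\ge 1$ with $q^m\equiv 3\pmod 4$. Let $N$ be an odd positive integer dividing $(q^m-1)/(q-1)$. Let $\psi_{\mathbb F_{q^m}}$ and $\psi_{\mathbb F_{q^{2m}}}$ be the canonical additive characters $x\mapsto e^{2\pi i\,\mathrm{Tr}(x)/p}$ ($p$ the characteristic, $\mathrm{Tr}$ the absolute trace), and write $\psi(D)=\sum_{x\in D}\psi(x)$ for a set $D$. Let $\eta$ be the quadratic character of $\mathbb F_{q^m}$ and $G(\eta)=\sum_{x\ne 0}\eta(x)\psi_{\mathbb F_{q^m}}(x)$. Let $\gamma$ be a primitive element of $\mathbb F_{q^{2m}}$ and $\omega=\gamma^{q^m+1}$, a primitive element of $\mathbb F_{q^m}$. Put $C_i^{(n,q^m)}=\omega^i\langle\omega^n\rangle$ and $C_i^{(n,q^{2m})}=\gamma^i\langle\gamma^n\rangle$. Assume that the Gauss periods $\psi_{\mathbb F_{q^m}}(C_i^{(N,q^m)})$, $0\le i\le N-1$, take exactly three rational values $\alpha_1,\alpha_2,\alpha_3$, with $\alpha_1-\alpha_2=\alpha_2-\alpha_3>0$. For $j=1,2,3$ let $I_j=\{i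 \bmod N:\psi_{\mathbb F_{q^m}}(C_i^{(N,q^m)})=\alpha_j\}$. Let $I_2=S_1\sqcup S_2$ be any partition into two (possibly empty) parts, and let $S_k''=4^{-1}S_k\pmod N$. Define $$X=2S_1''\cup(2S_2''+N)\pmod{2N},$$ $$Y_X=\{Ni+4j \bmod 4N:(i,j)\in(\{0,3\}\times S_1'')\cup(\{1,2\}\times S_2'')\cup(\{0,1,2,3\}\times 4^{-1}I_1)\},$$ $$D_X=\bigcup_{i\in Y_X}C_i^{(4N,q^{2m})},\qquad D_X'=\bigcup_{\ell\in X}C_\ell^{(2N,q^m)},\qquad D_{I_2}'=\bigcup_{\ell\in 2^{-1}I_2}C_\ell^{(N,q^m)}.$$ (a) We have $0\notin D_X=-D_X$. The nontrivial additive characters of $\mathbb F_{q^{2m}}$ are the maps $x\mapsto\psi_{\mathbb F_{q^{2m}}}(\gamma^a x)$, and the nontrivial character values of $D_X$ are as follows. For every integer $a$, with $b\equiv 4^{-1}a\pmod N$ and $c\equiv 2b\pmod{2N}$, $$\psi_{\mathbb F_{q^{2m}}}(\gamma^aD_X)=\frac{\rho\,\delta_a q^m}{2G(\eta)}\Bigl(2\psi_{\mathbb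 F_{q^m}}(\omega^cD_X')-\psi_{\mathbb F_{q^m}}(\omega^cD_{I_2}')\Bigr)+\frac{(q^m-1)(2|I_1|+|I_2|)}{2N}+\epsilon_a,$$ where $\epsilon_a=-q^m$, $-q^m/2$ or $0$ according as $a \bmod N$ lies in $I_1$, $I_2$ or $I_3$. Here $\rho=1$ if $q^m\equiv 7\pmod 8$ and $\rho=-1$ if $q^m\equiv 3\pmod 8$. Further, $\delta_a=1$ if $N\equiv 1\pmod 4$ and $a\equiv 0,1\pmod 4$, or if $N\equiv 3\pmod 4$ and $a\equiv 0,3\pmod 4$; otherwise $\delta_a=-1$. (b) Suppose that for every even integer $c$ the quantity $2\psi_{\mathbb F_{q^m}}(\omega^cD_X')-\psi_{\mathbb F_{q^m}}(\omega^cD_{I_2}')$ equals $G(\eta)$ or $-G(\eta)$ (the sign may depend on $c$) if $c \bmod N\in 2^{-1}I_2$, and equals $0$ otherwise. Then $r=(2|I_1|+|I_2|)(q^m-1)/(2N)$ is an integer, the set of nontrivial character values of $D_X$ is $\{r,\,r-q^m\}$, and $\mathrm{Cay}(\mathbb F_{q^{2m}},D_X)$ is strongly regular (neither complete nor edgeless)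 of negative Latin square type, with parameters $(q^{2m},\,r(q^m+1),\,-q^m+r^2+3r,\,r^2+r)$. -/

import Mathlib

open scoped Pointwise

noncomputable section

namespace ThreeValuedPeriods

/-- The canonical additive character `x ↦ exp (2 π i Tr(x) / p)` of a finite field of
characteristic `p`, where `Tr` is the trace to the prime field. -/
def canonicalChar (p : ℕ) [NeZero p] (F : Type*) [Field F] [Algebra (ZMod p) F] : AddChar F ℂ :=
  (ZMod.stdAddChar (N := p)).compAddMonoidHom (Algebra.trace (ZMod p) F).toAddMonoidHom

open Classical in
/-- The character sum `ψ(D) = ∑_{x ∈ D} ψ(x)`. -/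
def charSum {F : Type*} [Field F] [Fintype F] (ψ : AddChar F ℂ) (D : Set F) : ℂ :=
  ∑ x : F with x ∈ D, ψ x

open Classical in
/-- The Gauss sum `G(η)` of the quadratic character `η`. -/
def quadGaussSum {F : Type*} [Field F] [Fintype F] (ψ : AddChar F ℂ) : ℂ :=
  gaussSum ((quadraticChar F).ringHomComp (Int.castRingHom ℂ)) ψ

/-- The cyclotomic class `C_i = ω ^ i ⟨ω ^ n⟩` of order `n`. -/
def cyclotomicClass {F : Type*} [Field F] (ω : Fˣ) (n : ℕ) (i : ℤ) : Set F :=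
  {x | ∃ g ∈ Subgroup.zpowers (ω ^ n), x = ((ω ^ i * g : Fˣ) : F)}

/-- The union of the classes `C_i` of order `n` over the residues `i mod n` lying in `I`. -/
def cyclotomicUnion {F : Type*} [Field F] (ω : Fˣ) (n : ℕ) (I : Set (ZMod n)) : Set F :=
  ⋃ (i : ℤ) (_ : (i : ZMod n) ∈ I), cyclotomicClass ω n i

/-- The Gauss period `ψ(C_i)` of order `n`. -/
def gaussPeriod {F : Type*} [Field F] [Fintype F] (ψ : AddChar F ℂ) (ω : Fˣ) (n : ℕ) (i : ℤ) : ℂ :=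
  charSum ψ (cyclotomicClass ω n i)

/-- The residues `i mod n` for which the Gauss period `ψ(C_i)` equals `α`. -/
def periodSet {F : Type*} [Field F] [Fintype F] (ψ : AddChar F ℂ) (ω : Fˣ) (n : ℕ) (α : ℂ) :
    Set (ZMod n) :=
  (fun i : ℤ => (i : ZMod n)) '' {i : ℤ | gaussPeriod ψ ω n i = α}

/-- `2⁻¹ I` modulo `N`. -/
def halve {N : ℕ} (I : Set (ZMod N)) : Set (ZMod N) :=
  (fun s => (2 : ZMod N)⁻¹ * s) '' I

/-- `X = 2 S₁'' ∪ (2 S₂'' + N)` modulo `2 N`, where `S'' = 2⁻¹ (2⁻¹ S)` modulo `N`. -/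
def indexX (N : ℕ) (S₁ S₂ : Set (ZMod N)) : Set (ZMod (2 * N)) :=
  {x | ∃ j : ℤ, (j : ZMod N) ∈ halve (halve S₁) ∧ x = ((2 * j : ℤ) : ZMod (2 * N))} ∪
  {x | ∃ j : ℤ, (j : ZMod N) ∈ halve (halve S₂) ∧ x = ((2 * j + N : ℤ) : ZMod (2 * N))}

/-- `Y_X`: the residues `N i + 4 j` modulo `4 N` with `(i, j)` in `{0, 3} × S₁''`, in
`{1, 2} × S₂''`, or in `{0, 1, 2, 3} × 4⁻¹ I₁`. -/
def indexY (N : ℕ) (I₁ S₁ S₂ : Set (ZMod N)) : Set (ZMod (4 * N)) :=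
  {y | ∃ i j : ℤ,
    ((i ∈ ({0, 3} : Set ℤ) ∧ (j : ZMod N) ∈ halve (halve S₁)) ∨
     (i ∈ ({1, 2} : Set ℤ) ∧ (j : ZMod N) ∈ halve (halve S₂)) ∨
     (i ∈ ({0, 1, 2, 3} : Set ℤ) ∧ (j : ZMod N) ∈ halve (halve I₁))) ∧
    y = ((N * i + 4 * j : ℤ) : ZMod (4 * N))}

/-- The connection set `D_X`, the union of the classes of order `4 N` indexed by `Y_X`. -/
def connectionSet {F : Type*} [Field F] (γ : Fˣ) (N : ℕ) (I₁ S₁ S₂ : Set (ZMod N)) : Set F :=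
  cyclotomicUnion γ (4 * N) (indexY N I₁ S₁ S₂)

/-- `2 ψ(ω ^ c D_X') - ψ(ω ^ c D_{I₂}')`, where `D_X'` is the union of the classes of order `2 N`
indexed by `X` and `D_{I₂}'` is the union of the classes of order `N` indexed by `2⁻¹ I₂`. -/
def bracket {F : Type*} [Field F] [Fintype F] (ψ : AddChar F ℂ) (ω : Fˣ) (N : ℕ)
    (I₂ S₁ S₂ : Set (ZMod N)) (c : ℤ) : ℂ :=
  2 * charSum ψ (ω ^ c • cyclotomicUnion ω (2 * N) (indexX N S₁ S₂)) -
    charSum ψ (ω ^ c • cyclotomicUnion ω N (halve I₂))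

/-- The sign `ρ`, used for `Q ≡ 3 (mod 4)`: `1` if `Q ≡ 7 (mod 8)`, `-1` if `Q ≡ 3 (mod 8)`. -/
def rho (Q : ℕ) : ℂ := if Q % 8 = 7 then 1 else -1

/-- The sign `δ_a`, used for odd `N`. -/
def delta (N : ℕ) (a : ℤ) : ℂ :=
  if ((a % 4 = 0 ∨ a % 4 = 1) ∧ N % 4 = 1) ∨ ((a % 4 = 0 ∨ a % 4 = 3) ∧ N % 4 = 3) then 1 else -1

open Classical in
/-- `Γ` is strongly regular, neither complete nor edgeless, with the negative Latin square type
parameters `(n², r (n + 1), -n + r² + 3 r, r² + r)`. -/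
def IsNegativeLatinSquareType {V : Type*} [Fintype V] (Γ : SimpleGraph V) (n r : ℕ) : Prop :=
  Γ ≠ ⊥ ∧ Γ ≠ ⊤ ∧
    ∃ lam : ℕ, (lam : ℤ) = -n + r ^ 2 + 3 * r ∧
      Γ.IsSRGWith (n ^ 2) (r * (n + 1)) lam (r ^ 2 + r)

end ThreeValuedPeriods

end

/-! Write Q = q^m, let η be the quadratic character of K and G its Gauss sum. Membership of x ∈ Lˣ
in D depends on the logarithm of x modulo 4N. As N is odd, this splits into the logarithm modulo N,
which is that of the norm of x to the base ω, and the logarithm modulo 4. Accordingly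
(`ind_connectionSet`) the indicator of D is (1_{I₁} + ½ 1_{I₂})(norm) plus ½ (1_{S₁} − 1_{S₂})(norm)
times the sign δ, and the two summands are transformed separately.

The three periods being in arithmetic progression, 1_{I₁} + ½ 1_{I₂} is an affine function of the
Gauss period. Completing the square in the norm form shows that the Fourier transform carries
"period of the norm" to −Q times itself, up to a constant (`sum_period_norm`). This produces the
constant term and ε_a.

For the second summand, Q ≡ 3 (mod 4) makes the Frobenius x ↦ x^Q negate logarithms modulo 4 while
fixing norm and trace. Averaging over it leaves δ_a times a function supported on squares. Putting x
= w² and w = u + vI with I² = −1 turns the sum into an odd function of u² + v² against ψ(2(u² −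
v²)), a Salié-type sum that collapses to −2G times a single sum over K (`sum_sum_odd`,
`sum_deltaMod`). Since 2 is an N-th power in K, that sum is ρ times the bracket
(`sum_quadChar_dlog`, `bracket_eq`), and G² = −Q turns −G/2 into Q/(2G).

In the strongly regular case only the values r and r − Q survive. The quadratic equation they
satisfy, inverted by Fourier, gives the autocorrelation of D and hence all common-neighbour counts
(`sum_ind_mul_ind_sub`). -/

noncomputable section

namespace ThreeValuedPeriods

/-! ### Quadratic Gauss sums and a Salié-type sum over one field. -/

section OneField

variable {F : Type*} [Field F] [Fintype F]

open Classical in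
/-- The quadratic character of a finite field, with complex values. -/
def quadChar (F : Type*) [Field F] [Fintype F] : MulChar F ℂ :=
  (quadraticChar F).ringHomComp (Int.castRingHom ℂ)

open Classical in
lemma quadChar_apply (x : F) : quadChar F x = ((quadraticChar F x : ℤ) : ℂ) := rfl

lemma quadChar_mul_self {x : F} (hx : x ≠ 0) : quadChar F x * quadChar F x = 1 := by
  classical
  rw [← map_mul, quadChar_apply, ← sq, quadraticChar_sq_one' hx, Int.cast_one]

lemma quadChar_sq {x : F} (hx : x ≠ 0) : quadChar F (x ^ 2) = 1 := by
  rw [sq, map_mul, quadChar_mul_self hx]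

/-- The number of square roots of `x` is `1 + η(x)`. -/
lemma sum_comp_sq (hF : ringChar F ≠ 2) (f : F → ℂ) :
    ∑ x, f (x ^ 2) = ∑ x, (1 + quadChar F x) * f x := by
  classical
  rw [← Finset.sum_fiberwise_of_maps_to (s := Finset.univ) (t := Finset.univ)
    (g := fun x : F => x ^ 2) (fun _ _ => Finset.mem_univ _)]
  refine Finset.sum_congr rfl fun y _ => ?_
  rw [Finset.sum_congr rfl (g := fun _ => f y)
    (fun x hx => by rw [(Finset.mem_filter.mp hx).2]), Finset.sum_const, nsmul_eq_mul]
  congr 1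
  have h := quadraticChar_card_sqrts hF y
  have h2 : {x : F | x ^ 2 = y}.toFinset = Finset.univ.filter (fun x : F => x ^ 2 = y) := by
    ext; simp
  rw [h2] at h
  rw [quadChar_apply, add_comm]
  rw [← Int.cast_natCast, h]
  push_cast
  congr!

lemma sum_quadChar_mulShift (ψ : AddChar F ℂ) {u : F} (hu : u ≠ 0) :
    ∑ x, quadChar F x * ψ (u * x) = quadChar F u * quadGaussSum ψ := by
  have h := gaussSum_mulShift (quadChar F) ψ (Units.mk0 u hu)
  have h2 : gaussSum (quadChar F) (ψ.mulShift (Units.mk0 u hu)) =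
      ∑ x, quadChar F x * ψ (u * x) := rfl
  rw [h2] at h
  change _ = _ * gaussSum (quadChar F) ψ
  rw [← h, ← mul_assoc, Units.val_mk0, quadChar_mul_self hu, one_mul]

lemma sum_mulShift_eq_zero {ψ : AddChar F ℂ} (hψ : ψ.IsPrimitive) {u : F} (hu : u ≠ 0) :
    ∑ x, ψ (u * x) = 0 :=
  AddChar.sum_eq_zero_of_ne_one (hψ hu)

lemma sum_addChar_sq (hF : ringChar F ≠ 2) {ψ : AddChar F ℂ} (hψ : ψ.IsPrimitive) {u : F}
    (hu : u ≠ 0) : ∑ x, ψ (u * x ^ 2) = quadChar F u * quadGaussSum ψ := by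
  rw [sum_comp_sq hF (fun x => ψ (u * x))]
  simp only [add_mul, one_mul, Finset.sum_add_distrib]
  rw [sum_mulShift_eq_zero hψ hu, zero_add, sum_quadChar_mulShift ψ hu]

lemma ringChar_ne_two (hQ : Fintype.card F % 4 = 3) : ringChar F ≠ 2 := by
  intro h
  have := FiniteField.even_card_of_char_two h
  omega

lemma not_isSquare_neg_one (hQ : Fintype.card F % 4 = 3) : ¬ IsSquare (-1 : F) := by
  rw [FiniteField.isSquare_neg_one_iff]; simpa using hQ

lemma quadChar_neg_one (hQ : Fintype.card F % 4 = 3) : quadChar F (-1) = -1 := by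
  classical
  have : quadraticChar F (-1) = -1 :=
    quadraticChar_neg_one_iff_not_isSquare.mpr (not_isSquare_neg_one hQ)
  rw [quadChar_apply]
  have h2 : ((-1 : ℤ) : ℂ) = -1 := by simp
  rw [← h2, ← this]

lemma quadChar_neg (hQ : Fintype.card F % 4 = 3) (x : F) : quadChar F (-x) = -quadChar F x := by
  rw [neg_eq_neg_one_mul, map_mul, quadChar_neg_one hQ, neg_one_mul]

lemma quadGaussSum_sq (hQ : Fintype.card F % 4 = 3) {ψ : AddChar F ℂ} (hψ : ψ.IsPrimitive) :
    quadGaussSum ψ ^ 2 = -(Fintype.card F : ℂ) := by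
  classical
  have h := gaussSum_sq (χ := quadChar F) (ψ := ψ) ?_ ?_ hψ
  · rw [quadChar_neg_one hQ, neg_one_mul] at h
    exact h
  · intro h
    have := congrArg (fun χ : MulChar F ℂ => χ (-1)) h
    simp only [quadChar_neg_one hQ] at this
    rw [MulChar.one_apply (by simp)] at this
    norm_num at this
  · exact quadraticChar_isQuadratic F |>.comp _

lemma quadGaussSum_ne_zero (hQ : Fintype.card F % 4 = 3) {ψ : AddChar F ℂ}
    (hψ : ψ.IsPrimitive) : quadGaussSum ψ ≠ 0 := by
  intro h
  have := quadGaussSum_sq hQ hψ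
  rw [h] at this
  have : (Fintype.card F : ℂ) = 0 := by linear_combination this
  exact Fintype.card_ne_zero (Nat.cast_eq_zero.mp this)

lemma quadChar_two (hQ : Fintype.card F % 4 = 3) : quadChar F 2 = rho (Fintype.card F) := by
  classical
  have h := quadraticChar_two (F := F) (ringChar_ne_two hQ)
  have h2 : quadChar F 2 = ((ZMod.χ₈ (Fintype.card F : ℕ) : ℤ) : ℂ) := by
    rw [← h, quadChar_apply]
  rw [h2, ZMod.χ₈_nat_eq_if_mod_eight, rho]
  have : Fintype.card F % 8 = 3 ∨ Fintype.card F % 8 = 7 := by omega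
  have h3 : Fintype.card F % 2 = 1 := by omega
  rcases this with h | h <;> simp [h, h3]

lemma two_ne_zero_of_card (hQ : Fintype.card F % 4 = 3) : (2 : F) ≠ 0 :=
  Ring.two_ne_zero (ringChar_ne_two hQ)

lemma quadChar_four (hQ : Fintype.card F % 4 = 3) : quadChar F 4 = 1 := by
  have h := quadChar_sq (two_ne_zero_of_card hQ)
  norm_num at h
  exact h

/-- A Salié type evaluation: the average of an odd function against `ψ (2 (x ^ 2 - y ^ 2))`. -/
lemma sum_sum_odd (hQ : Fintype.card F % 4 = 3) {ψ : AddChar F ℂ} (hψ : ψ.IsPrimitive)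
    {B : F → ℂ} (hB : ∀ n, B (-n) = -B n) :
    ∑ x, ∑ y, B (x ^ 2 + y ^ 2) * ψ (2 * (x ^ 2 - y ^ 2)) =
      -2 * quadGaussSum ψ * ∑ n, B n * ψ (2 * n) := by
  have hF := ringChar_ne_two hQ
  have h4 : (4 : F) ≠ 0 := by
    have := pow_ne_zero 2 (two_ne_zero_of_card hQ)
    norm_num at this; exact this
  have hsq : ∑ x : F, ∑ y : F, B (x ^ 2 + y ^ 2) * ψ (2 * (x ^ 2 - y ^ 2)) =
      ∑ s, ∑ t, (1 + quadChar F s) * ((1 + quadChar F t) * (B (s + t) * ψ (2 * (s - t)))) := by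
    simp_rw [← Finset.mul_sum]
    rw [← sum_comp_sq hF (fun s => ∑ t, (1 + quadChar F t) * (B (s + t) * ψ (2 * (s - t))))]
    refine Finset.sum_congr rfl fun x _ => ?_
    exact sum_comp_sq hF (fun t => B (x ^ 2 + t) * ψ (2 * (x ^ 2 - t)))
  rw [hsq]
  -- After the substitution n = s + t, this collects the term of the expansion containing both
  -- quadratic characters.
  set J : F → ℂ := fun n => ∑ s, quadChar F s * quadChar F (n - s) * ψ (4 * s) with hJ
  -- In other words n ↦ J(n) ψ(−2n) is even: η is odd and occurs twice. Hence its sum against the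
  -- odd function B vanishes.
  have hJodd : ∀ n, J (-n) * ψ (2 * n) = J n * ψ (-2 * n) := by
    intro n
    simp only [hJ, Finset.sum_mul]
    refine Fintype.sum_equiv (Equiv.addRight n) _ _ fun s => ?_
    rw [mul_assoc (_ * _), mul_assoc (_ * _), ← AddChar.map_add_eq_mul, ← AddChar.map_add_eq_mul,
      Equiv.coe_addRight]
    have h1 : -n - s = -(s + n) := by ring
    have h2 : n - (s + n) = -s := by ring
    rw [h1, h2, quadChar_neg hQ, quadChar_neg hQ]
    have h3 : 4 * (s + n) + -2 * n = 4 * s + 2 * n := by ring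
    rw [h3]; ring
  have hshift : ∀ n : F, ∑ s, quadChar F (n - s) * ψ (4 * s) =
      -(ψ (4 * n) * quadGaussSum ψ) := by
    intro n
    have : ∑ s, quadChar F (n - s) * ψ (4 * s) =
        ∑ s, ψ (4 * n) * (quadChar F s * ψ (-4 * s)) := by
      refine Fintype.sum_equiv (Equiv.subLeft n) _ _ fun s => ?_
      rw [Equiv.subLeft_apply, mul_left_comm, ← AddChar.map_add_eq_mul]
      congr 2; ring
    rw [this, ← Finset.mul_sum, sum_quadChar_mulShift ψ (neg_ne_zero.mpr h4),
      quadChar_neg hQ, quadChar_four hQ]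
    ring
  have key : ∀ n, ∑ s, (1 + quadChar F s) * ((1 + quadChar F (n - s)) *
      (B n * ψ (2 * (s - (n - s))))) =
      B n * ψ (-2 * n) * quadGaussSum ψ - B n * ψ (2 * n) * quadGaussSum ψ +
        B n * (J n * ψ (-2 * n)) := by
    intro n
    have h1 : ∀ s, (1 + quadChar F s) * ((1 + quadChar F (n - s)) *
        (B n * ψ (2 * (s - (n - s))))) = B n * ψ (-2 * n) * (ψ (4 * s) + quadChar F s * ψ (4 * s)
          + quadChar F (n - s) * ψ (4 * s) + quadChar F s * quadChar F (n - s) * ψ (4 * s)) := by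
      intro s
      have : 2 * (s - (n - s)) = -2 * n + 4 * s := by ring
      rw [this, AddChar.map_add_eq_mul]; ring
    simp_rw [h1]
    rw [← Finset.mul_sum]
    simp only [Finset.sum_add_distrib]
    rw [sum_mulShift_eq_zero hψ h4, sum_quadChar_mulShift ψ h4, hshift, quadChar_four hQ]
    have h5 : (4 : F) * n = 2 * n + 2 * n := by ring
    have h6 : ψ (-2 * n) * ψ (2 * n) = 1 := by
      rw [← AddChar.map_add_eq_mul]
      have : -2 * n + 2 * n = 0 := by ring
      rw [this, AddChar.map_zero_eq_one]
    rw [h5, AddChar.map_add_eq_mul]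
    linear_combination (-B n * ψ (2 * n) * quadGaussSum ψ) * h6
  have hre : ∑ s, ∑ t, (1 + quadChar F s) * ((1 + quadChar F t) *
      (B (s + t) * ψ (2 * (s - t)))) = ∑ n, ∑ s, (1 + quadChar F s) *
        ((1 + quadChar F (n - s)) * (B n * ψ (2 * (s - (n - s))))) := by
    rw [Finset.sum_comm (s := Finset.univ (α := F)) (t := Finset.univ (α := F))
      (f := fun n s => (1 + quadChar F s) *
        ((1 + quadChar F (n - s)) * (B n * ψ (2 * (s - (n - s))))))]
    refine Finset.sum_congr rfl fun s _ => ?_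
    refine Fintype.sum_equiv (Equiv.addLeft s) _ _ fun t => ?_
    simp
  rw [hre]
  simp_rw [key]
  rw [Finset.sum_add_distrib, Finset.sum_sub_distrib]
  -- By oddness of B the two terms linear in η contribute equally, whence the factor −2.
  have e1 : ∑ n, B n * ψ (-2 * n) * quadGaussSum ψ =
      -(∑ n, B n * ψ (2 * n) * quadGaussSum ψ) := by
    rw [← Finset.sum_neg_distrib]
    refine Fintype.sum_equiv (Equiv.neg F) _ _ fun n => ?_
    simp [hB]
  have e2 : ∑ n, B n * (J n * ψ (-2 * n)) = 0 := by
    have : ∑ n, B n * (J n * ψ (-2 * n)) = -∑ n, B n * (J n * ψ (-2 * n)) := by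
      nth_rewrite 1 [← Equiv.sum_comp (Equiv.neg F)]
      rw [← Finset.sum_neg_distrib]
      refine Finset.sum_congr rfl fun n _ => ?_
      rw [Equiv.neg_apply, hB, ← hJodd n]
      have : -2 * -n = 2 * n := by ring
      rw [this]; ring
    exact self_eq_neg.mp this
  rw [e1, e2, ← Finset.sum_mul]
  ring

end OneField

/-! ### The quadratic extension in coordinates x + yI, with I² = −1. -/

section QuadraticExtension

variable {K L : Type*} [Field K] [Fintype K] [Field L] [Fintype L] [Algebra K L]

lemma finrank_eq_two (hL : Fintype.card L = Fintype.card K ^ 2) : Module.finrank K L = 2 := by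
  have h := Module.card_eq_pow_finrank (K := K) (V := L)
  rw [hL] at h
  exact (Nat.pow_right_injective Fintype.one_lt_card h).symm

omit [Field K] [Algebra K L] in
lemma exists_sq_eq_neg_one (hQ : Fintype.card K % 4 = 3)
    (hL : Fintype.card L = Fintype.card K ^ 2) : ∃ I : L, I ^ 2 = -1 := by
  have h : IsSquare (-1 : L) := by
    rw [FiniteField.isSquare_neg_one_iff, hL, Nat.pow_mod, hQ]; decide
  obtain ⟨I, hI⟩ := h
  exact ⟨I, by rw [sq, hI]⟩

/-- Every element of `L` is uniquely `x + y I`. -/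
lemma bijective_add_mul (hQ : Fintype.card K % 4 = 3)
    (hL : Fintype.card L = Fintype.card K ^ 2) {I : L} (hI : I ^ 2 = -1) :
    Function.Bijective
      (fun z : K × K => algebraMap K L z.1 + algebraMap K L z.2 * I) := by
  have hI' : ∀ a : K, algebraMap K L a ≠ I := by
    rintro a ha
    apply not_isSquare_neg_one hQ
    refine ⟨a, (algebraMap K L).injective ?_⟩
    rw [map_mul, ha, ← sq, hI]; simp
  rw [Fintype.bijective_iff_injective_and_card]
  refine ⟨?_, by rw [Fintype.card_prod, hL, sq]⟩
  rintro ⟨x, y⟩ ⟨x', y'⟩ h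
  dsimp only at h
  by_cases hy : y = y'
  · subst hy
    have := (algebraMap K L).injective (add_right_cancel h)
    rw [this]
  · exfalso
    apply hI' ((x' - x) / (y - y'))
    have h2 : algebraMap K L (y - y') ≠ 0 := by
      rw [map_ne_zero]; exact sub_ne_zero.mpr hy
    rw [map_div₀, div_eq_iff h2]
    simp only [map_sub]
    linear_combination -h

omit [Field K] [Fintype L] [Algebra K L] in
lemma pow_card_I (hQ : Fintype.card K % 4 = 3) {I : L} (hI : I ^ 2 = -1) :
    I ^ Fintype.card K = -I := by
  have h4 : I ^ 4 = 1 := by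
    have : I ^ 4 = (I ^ 2) ^ 2 := by ring
    rw [this, hI]; ring
  rw [← Nat.div_add_mod (Fintype.card K) 4, hQ, pow_add, pow_mul, h4, one_pow, one_mul, pow_succ,
    hI, neg_one_mul]

-- The Q-th power map fixes K and sends I to −I because Q ≡ 3 (mod 4), so it acts as conjugation.
omit [Fintype L] in
lemma pow_card_add_mul (hQ : Fintype.card K % 4 = 3) {I : L} (hI : I ^ 2 = -1) (x y : K) :
    (algebraMap K L x + algebraMap K L y * I) ^ Fintype.card K =
      algebraMap K L x - algebraMap K L y * I := by
  have h := map_add (FiniteField.frobeniusAlgHom K L) (algebraMap K L x) (algebraMap K L y * I)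
  rw [map_mul] at h
  simp only [AlgHom.commutes] at h
  rw [FiniteField.coe_frobeniusAlgHom] at h
  simp only [pow_card_I hQ hI] at h
  rw [h]; ring

lemma norm_eq_pow (hL : Fintype.card L = Fintype.card K ^ 2) (z : L) :
    algebraMap K L (Algebra.norm K z) = z ^ (Fintype.card K + 1) := by
  rw [FiniteField.algebraMap_norm_eq_pow_sum, finrank_eq_two hL, Nat.card_eq_fintype_card]
  simp [Finset.sum_range_succ, add_comm]

lemma norm_add_mul (hQ : Fintype.card K % 4 = 3) (hL : Fintype.card L = Fintype.card K ^ 2)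
    {I : L} (hI : I ^ 2 = -1) (x y : K) :
    Algebra.norm K (algebraMap K L x + algebraMap K L y * I) = x ^ 2 + y ^ 2 := by
  apply (algebraMap K L).injective
  rw [norm_eq_pow hL, pow_succ, pow_card_add_mul hQ hI, map_add, map_pow, map_pow]
  linear_combination (-algebraMap K L y ^ 2) * hI

lemma trace_add_mul (hQ : Fintype.card K % 4 = 3) (hL : Fintype.card L = Fintype.card K ^ 2)
    {I : L} (hI : I ^ 2 = -1) (x y : K) :
    Algebra.trace K L (algebraMap K L x + algebraMap K L y * I) = 2 * x := by
  apply (algebraMap K L).injective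
  rw [FiniteField.algebraMap_trace_eq_sum_pow, finrank_eq_two hL, Nat.card_eq_fintype_card]
  simp only [Finset.sum_range_succ, Finset.sum_range_zero, pow_zero, pow_one]
  rw [pow_card_add_mul hQ hI, map_mul, map_ofNat]
  ring

lemma trace_pow_card (hL : Fintype.card L = Fintype.card K ^ 2) (z : L) :
    Algebra.trace K L (z ^ Fintype.card K) = Algebra.trace K L z := by
  apply (algebraMap K L).injective
  rw [FiniteField.algebraMap_trace_eq_sum_pow, FiniteField.algebraMap_trace_eq_sum_pow,
    finrank_eq_two hL, Nat.card_eq_fintype_card]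
  simp only [Finset.sum_range_succ, Finset.sum_range_zero, pow_zero, pow_one]
  rw [← pow_mul, ← sq, ← hL, FiniteField.pow_card]
  ring

lemma sum_eq_sum_sum (hQ : Fintype.card K % 4 = 3)
    (hL : Fintype.card L = Fintype.card K ^ 2) {I : L} (hI : I ^ 2 = -1) (f : L → ℂ) :
    ∑ z, f z = ∑ x, ∑ y, f (algebraMap K L x + algebraMap K L y * I) := by
  rw [← Fintype.sum_prod_type']
  exact (Function.Bijective.sum_comp (bijective_add_mul hQ hL hI) f).symm

variable {ψ : AddChar K ℂ}

/-- In coordinates the norm is x² + y² and the trace of the square is 2(x² − y²), so `sum_sum_odd`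
applies. -/
lemma sum_odd_norm_mul_trace_sq (hQ : Fintype.card K % 4 = 3)
    (hL : Fintype.card L = Fintype.card K ^ 2) (hψ : ψ.IsPrimitive) {B : K → ℂ}
    (hB : ∀ n, B (-n) = -B n) :
    ∑ z : L, B (Algebra.norm K z) * ψ (Algebra.trace K L (z ^ 2)) =
      -2 * quadGaussSum ψ * ∑ n, B n * ψ (2 * n) := by
  obtain ⟨I, hI⟩ := exists_sq_eq_neg_one hQ hL
  rw [sum_eq_sum_sum hQ hL hI, ← sum_sum_odd hQ hψ hB]
  refine Finset.sum_congr rfl fun x _ => Finset.sum_congr rfl fun y _ => ?_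
  have : (algebraMap K L x + algebraMap K L y * I) ^ 2 =
      algebraMap K L (x ^ 2 - y ^ 2) + algebraMap K L (2 * x * y) * I := by
    simp only [map_sub, map_mul, map_pow, map_ofNat]
    linear_combination (algebraMap K L y) ^ 2 * hI
  rw [norm_add_mul hQ hL hI, this, trace_add_mul hQ hL hI]

/-- Completing the square for the norm form. -/
lemma sum_norm_mul_trace (hQ : Fintype.card K % 4 = 3)
    (hL : Fintype.card L = Fintype.card K ^ 2) (hψ : ψ.IsPrimitive) {u : K} (hu : u ≠ 0) (β : L) :
    ∑ z : L, ψ (u * Algebra.norm K z) * ψ (Algebra.trace K L (β * z)) =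
      -(Fintype.card K : ℂ) * ψ (-Algebra.norm K β * u⁻¹) := by
  obtain ⟨I, hI⟩ := exists_sq_eq_neg_one hQ hL
  obtain ⟨⟨b, c⟩, rfl⟩ := (bijective_add_mul hQ hL hI).2 β
  dsimp only
  rw [sum_eq_sum_sum hQ hL hI, norm_add_mul hQ hL hI]
  -- The square is completed in x and y separately. Each variable then contributes η(u)G, and the
  -- product is G² = −Q.
  have h : ∀ x y : K, ψ (u * Algebra.norm K (algebraMap K L x + algebraMap K L y * I)) *
      ψ (Algebra.trace K L ((algebraMap K L b + algebraMap K L c * I) *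
        (algebraMap K L x + algebraMap K L y * I))) =
      ψ (-(b ^ 2 + c ^ 2) * u⁻¹) *
        (ψ (u * (x + b * u⁻¹) ^ 2) * ψ (u * (y + -(c * u⁻¹)) ^ 2)) := by
    intro x y
    have : (algebraMap K L b + algebraMap K L c * I) *
        (algebraMap K L x + algebraMap K L y * I) =
        algebraMap K L (b * x - c * y) + algebraMap K L (b * y + c * x) * I := by
      simp only [map_sub, map_mul, map_add]
      linear_combination (algebraMap K L y) * (algebraMap K L c) * hI
    rw [norm_add_mul hQ hL hI, this, trace_add_mul hQ hL hI]
    simp only [← AddChar.map_add_eq_mul]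
    congr 1
    field_simp
    ring
  simp_rw [h, ← Finset.mul_sum, ← Finset.sum_mul]
  have h1 : ∀ d : K, ∑ x, ψ (u * (x + d) ^ 2) = quadChar K u * quadGaussSum ψ := by
    intro d
    rw [← sum_addChar_sq (ringChar_ne_two hQ) hψ hu]
    exact Equiv.sum_comp (Equiv.addRight d) (fun x => ψ (u * x ^ 2))
  rw [h1, h1]
  linear_combination ψ (-(b ^ 2 + c ^ 2) * u⁻¹) * quadChar K u * quadChar K u *
    quadGaussSum_sq hQ hψ - ψ (-(b ^ 2 + c ^ 2) * u⁻¹) * (Fintype.card K) *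
      quadChar_mul_self hu

/-- The norm on units. -/
def normUnits (K : Type*) {L : Type*} [Field K] [Field L] [Algebra K L] : Lˣ →* Kˣ :=
  Units.map (Algebra.norm K)

omit [Fintype K] [Fintype L] in
lemma coe_normUnits (x : Lˣ) : (normUnits K x : K) = Algebra.norm K (x : L) := rfl

end QuadraticExtension

/-! ### Canonical additive characters and transitivity of the trace. -/

section CanonicalChar

variable {p : ℕ} [Fact p.Prime]

lemma canonicalChar_isPrimitive (F : Type*) [Field F] [Finite F] [Algebra (ZMod p) F] :
    (canonicalChar p F).IsPrimitive := by
  apply AddChar.IsPrimitive.of_ne_one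
  obtain ⟨x, hx⟩ := Algebra.trace_surjective (ZMod p) F 1
  rw [AddChar.ne_one_iff]
  refine ⟨x, ?_⟩
  have h : canonicalChar p F x = ZMod.stdAddChar (N := p) 1 := by
    rw [← hx]; rfl
  rw [h]
  intro h1
  rw [← AddChar.map_zero_eq_one (ZMod.stdAddChar (N := p))] at h1
  exact one_ne_zero (ZMod.injective_stdAddChar h1)

lemma canonicalChar_eq_trace {K L : Type*} [Field K] [Finite K] [Field L] [Finite L]
    [Algebra (ZMod p) K] [Algebra (ZMod p) L] [Algebra K L] (x : L) :
    canonicalChar p L x = canonicalChar p K (Algebra.trace K L x) := by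
  have : IsScalarTower (ZMod p) K L :=
    IsScalarTower.of_algebraMap_eq' (Subsingleton.elim _ _)
  change ZMod.stdAddChar (Algebra.trace (ZMod p) L x) =
    ZMod.stdAddChar (Algebra.trace (ZMod p) K (Algebra.trace K L x))
  rw [Algebra.trace_trace]

end CanonicalChar

/-! ### Discrete logarithms modulo n. -/

section DiscreteLog

variable {G : Type*} [CommGroup G] {g : G} {n : ℕ}

open Classical in
/-- The discrete logarithm to the base `g`, reduced modulo `n`. -/
def dlog (g : G) (n : ℕ) (x : G) : ZMod n :=
  if h : ∃ s : ℤ, g ^ s = x then ((h.choose : ℤ) : ZMod n) else 0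

lemma dlog_zpow (hn : n ∣ orderOf g) (s : ℤ) : dlog g n (g ^ s) = s := by
  have h : ∃ t : ℤ, g ^ t = g ^ s := ⟨s, rfl⟩
  rw [dlog, dif_pos h]
  have h1 := zpow_eq_zpow_iff_modEq.mp h.choose_spec
  exact (ZMod.intCast_eq_intCast_iff _ _ _).mpr (h1.of_dvd (by exact_mod_cast hn))

lemma dlog_mul (hg : ∀ x, x ∈ Subgroup.zpowers g) (hn : n ∣ orderOf g) (x y : G) :
    dlog g n (x * y) = dlog g n x + dlog g n y := by
  obtain ⟨s, rfl⟩ := hg x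
  obtain ⟨t, rfl⟩ := hg y
  simp only [← zpow_add, dlog_zpow hn]
  push_cast; rfl

lemma dlog_inv (hg : ∀ x, x ∈ Subgroup.zpowers g) (hn : n ∣ orderOf g) (x : G) :
    dlog g n x⁻¹ = -dlog g n x := by
  obtain ⟨s, rfl⟩ := hg x
  simp only [← zpow_neg, dlog_zpow hn]
  push_cast; rfl

lemma dlog_pow (hg : ∀ x, x ∈ Subgroup.zpowers g) (hn : n ∣ orderOf g) (x : G) (k : ℕ) :
    dlog g n (x ^ k) = k * dlog g n x := by
  obtain ⟨s, rfl⟩ := hg x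
  simp only [← zpow_natCast, ← zpow_mul, dlog_zpow hn]
  push_cast; ring

lemma dlog_surjective (hn : n ∣ orderOf g) : Function.Surjective (dlog g n) := fun j => by
  obtain ⟨s, rfl⟩ := ZMod.intCast_surjective j
  exact ⟨g ^ s, dlog_zpow hn s⟩

/-- For x = g^s the order of g divides sk, hence nk divides sk and k cancels. This shows that −1 and
2 are N-th powers. -/
lemma dlog_eq_zero_of_pow_eq_one (hg : ∀ x, x ∈ Subgroup.zpowers g) {k : ℕ} {x : G}
    (hk : n * k ∣ orderOf g) (hk0 : k ≠ 0) (hx : x ^ k = 1) : dlog g n x = 0 := by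
  have hn : n ∣ orderOf g := (Dvd.intro _ rfl).trans hk
  obtain ⟨s, rfl⟩ := hg x
  dsimp only at hx ⊢
  rw [dlog_zpow hn, ZMod.intCast_zmod_eq_zero_iff_dvd]
  rw [← zpow_natCast, ← zpow_mul, ← orderOf_dvd_iff_zpow_eq_one] at hx
  have h : ((n * k : ℕ) : ℤ) ∣ s * k := (Int.natCast_dvd_natCast.mpr hk).trans hx
  push_cast at h
  exact Int.dvd_of_mul_dvd_mul_right (by exact_mod_cast hk0) h

/-- All fibres of the discrete logarithm have the same size. -/
lemma sum_comp_dlog [Fintype G] [NeZero n] (hg : ∀ x, x ∈ Subgroup.zpowers g)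
    (hn : n ∣ orderOf g) (f : ZMod n → ℂ) :
    ∑ x, f (dlog g n x) = (Fintype.card G : ℂ) / n * ∑ j, f j := by
  have h : ∀ j : ZMod n, ∑ x, f (dlog g n x + j) = ∑ x, f (dlog g n x) := by
    intro j
    obtain ⟨y, rfl⟩ := dlog_surjective hn j
    simp_rw [← dlog_mul hg hn]
    exact Equiv.sum_comp (Equiv.mulRight y) (fun x => f (dlog g n x))
  have h1 : ∑ j : ZMod n, ∑ x, f (dlog g n x + j) = n * ∑ x, f (dlog g n x) := by
    simp_rw [h]; simp
  rw [Finset.sum_comm] at h1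
  have h2 : ∀ x : G, ∑ j : ZMod n, f (dlog g n x + j) = ∑ j, f j := fun x =>
    Equiv.sum_comp (Equiv.addLeft (dlog g n x)) f
  simp_rw [h2] at h1
  simp only [Finset.sum_const, nsmul_eq_mul, Finset.card_univ] at h1
  have hn0 : (n : ℂ) ≠ 0 := NeZero.ne _
  field_simp
  linear_combination -h1

end DiscreteLog

/-! ### Sums over units, cyclotomic classes and Gauss periods. -/

section Units

open scoped Classical

variable {F : Type*} [Field F] [Fintype F]

lemma sum_units_eq (f : F → ℂ) : ∑ x : Fˣ, f x = ∑ x, f x - f 0 := by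
  rw [← Finset.sum_erase_eq_sub (Finset.mem_univ 0)]
  refine Finset.sum_bij' (fun x _ => (x : F))
    (fun x hx => Units.mk0 x (Finset.ne_of_mem_erase hx)) ?_ ?_ ?_ ?_ ?_ <;> simp

/-- Extension of a function on the units by zero. -/
def extendZero (f : Fˣ → ℂ) (x : F) : ℂ := if h : x = 0 then 0 else f (Units.mk0 x h)

omit [Fintype F] in
@[simp] lemma extendZero_zero (f : Fˣ → ℂ) : extendZero f 0 = 0 := by simp [extendZero]

omit [Fintype F] in
@[simp] lemma extendZero_coe (f : Fˣ → ℂ) (x : Fˣ) : extendZero f (x : F) = f x := by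
  simp [extendZero]

lemma sum_units_comp_sq (hF : ringChar F ≠ 2) (f : Fˣ → ℂ) :
    ∑ x, f (x ^ 2) = ∑ x : Fˣ, (1 + quadChar F x) * f x := by
  have h := sum_comp_sq hF (extendZero f)
  have h1 := sum_units_eq (fun x => extendZero f (x ^ 2))
  have h2 := sum_units_eq (fun x => (1 + quadChar F x) * extendZero f x)
  simp only [← Units.val_pow_eq_pow_val, extendZero_coe] at h1 h2
  rw [h1, h2, h]
  simp

variable {ω : Fˣ} {n : ℕ}

omit [Fintype F] in
lemma coe_mem_cyclotomicUnion (hω : ∀ x : Fˣ, x ∈ Subgroup.zpowers ω) (hn : n ∣ orderOf ω)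
    {I : Set (ZMod n)} {x : Fˣ} : (x : F) ∈ cyclotomicUnion ω n I ↔ dlog ω n x ∈ I := by
  simp only [cyclotomicUnion, cyclotomicClass, Set.mem_iUnion, Set.mem_ofPred_eq, Units.val_inj]
  constructor
  · rintro ⟨i, hi, _, ⟨k, rfl⟩, rfl⟩
    have : ω ^ i * (ω ^ n) ^ k = ω ^ (i + n * k) := by
      rw [zpow_add, zpow_mul, zpow_natCast]
    dsimp only
    rw [this, dlog_zpow hn]
    simpa using hi
  · obtain ⟨s, rfl⟩ := hω x
    intro h
    dsimp only at h
    rw [dlog_zpow hn] at h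
    exact ⟨s, h, 1, one_mem _, by simp⟩

omit [Fintype F] in
lemma zero_notMem_cyclotomicUnion {I : Set (ZMod n)} : (0 : F) ∉ cyclotomicUnion ω n I := by
  simp only [cyclotomicUnion, cyclotomicClass, Set.mem_iUnion, Set.mem_ofPred_eq, not_exists]
  rintro i hi g ⟨-, hg⟩
  exact Units.ne_zero (ω ^ i * g) hg.symm

lemma charSum_eq_sum_units (ψ : AddChar F ℂ) {D : Set F} (hD : (0 : F) ∉ D) :
    charSum ψ D = ∑ x : Fˣ, if (x : F) ∈ D then ψ x else 0 := by
  rw [sum_units_eq (fun x => if x ∈ D then ψ x else 0), charSum, Finset.sum_filter]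
  simp [hD]

lemma charSum_smul (ψ : AddChar F ℂ) {D : Set F} (hD : (0 : F) ∉ D) (u : Fˣ) :
    charSum ψ (u • D) = ∑ x : Fˣ, if (x : F) ∈ D then ψ (u * x) else 0 := by
  have h0 : (0 : F) ∉ u • D := by
    rw [Set.mem_smul_set_iff_inv_smul_mem, smul_zero]; exact hD
  rw [charSum_eq_sum_units ψ h0]
  refine (Fintype.sum_equiv (Equiv.mulLeft u) _ _ fun x => ?_).symm
  have : ((u * x : Fˣ) : F) ∈ u • D ↔ (x : F) ∈ D := by
    rw [Units.val_mul, ← smul_eq_mul, ← Units.smul_def, Set.smul_mem_smul_set_iff]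
  simp only [Equiv.coe_mulLeft, this]
  simp

/-- The Gauss period as a function on residue classes. -/
def period (ψ : AddChar F ℂ) (ω : Fˣ) (n : ℕ) (j : ZMod n) : ℂ :=
  ∑ x : Fˣ, if dlog ω n x = j then ψ x else 0

lemma gaussPeriod_eq (hω : ∀ x : Fˣ, x ∈ Subgroup.zpowers ω) (hn : n ∣ orderOf ω)
    (ψ : AddChar F ℂ) (i : ℤ) : gaussPeriod ψ ω n i = period ψ ω n i := by
  have h : cyclotomicClass ω n i = cyclotomicUnion ω n {(i : ZMod n)} := by
    ext x
    simp only [cyclotomicUnion, Set.mem_iUnion, Set.mem_singleton_iff]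
    refine ⟨fun h => ⟨i, rfl, h⟩, ?_⟩
    rintro ⟨j, hj, g, hg, rfl⟩
    rw [ZMod.intCast_eq_intCast_iff_dvd_sub] at hj
    obtain ⟨k, hk⟩ := hj
    refine ⟨(ω ^ n) ^ (-k) * g, mul_mem (Subgroup.zpow_mem _ (Subgroup.mem_zpowers _) _) hg, ?_⟩
    have hj : j = i + n * (-k) := by linear_combination -hk
    rw [hj, zpow_add, zpow_mul, zpow_natCast, mul_assoc]
  rw [gaussPeriod, h, charSum_eq_sum_units ψ zero_notMem_cyclotomicUnion, period]
  simp only [coe_mem_cyclotomicUnion hω hn, Set.mem_singleton_iff]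

lemma periodSet_eq (hω : ∀ x : Fˣ, x ∈ Subgroup.zpowers ω) (hn : n ∣ orderOf ω)
    (ψ : AddChar F ℂ) (α : ℂ) : periodSet ψ ω n α = {j | period ψ ω n j = α} := by
  ext j
  obtain ⟨i, rfl⟩ := ZMod.intCast_surjective j
  simp only [periodSet, gaussPeriod_eq hω hn, Set.mem_image, Set.mem_ofPred_eq]
  exact ⟨fun ⟨k, hk, h⟩ => h ▸ hk, fun h => ⟨i, h, rfl⟩⟩

lemma sum_units_addChar {ψ : AddChar F ℂ} (hψ : ψ.IsPrimitive) : ∑ x : Fˣ, ψ x = -1 := by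
  rw [sum_units_eq ψ]
  have := sum_mulShift_eq_zero hψ one_ne_zero
  simp only [one_mul] at this
  rw [this]; simp

lemma sum_period [NeZero n] {ψ : AddChar F ℂ} (hψ : ψ.IsPrimitive) :
    ∑ j, period ψ ω n j = -1 := by
  simp only [period]
  rw [Finset.sum_comm]
  simp [sum_units_addChar hψ]

/-- Expresses the period at the class of y as a sum of ψ(uy) over n-th powers u, a form in which y
can be a norm and the square can be completed for each u. -/
lemma period_dlog (hω : ∀ x : Fˣ, x ∈ Subgroup.zpowers ω) (hn : n ∣ orderOf ω)
    (ψ : AddChar F ℂ) (y : Fˣ) : period ψ ω n (dlog ω n y) =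
      ∑ u : Fˣ, if dlog ω n u = 0 then ψ (u * y) else 0 := by
  rw [period]
  refine (Fintype.sum_equiv (Equiv.mulRight y) _ _ fun u => ?_).symm
  simp [dlog_mul hω hn]

/-- The weighted sum of a cyclotomic function of the norm. -/
lemma sum_period_norm {K L : Type*} [Field K] [Fintype K] [Field L] [Fintype L] [Algebra K L]
    (hQ : Fintype.card K % 4 = 3) (hL : Fintype.card L = Fintype.card K ^ 2)
    {ψ : AddChar K ℂ} (hψ : ψ.IsPrimitive) {ω : Kˣ} [NeZero n]
    (hω : ∀ x : Kˣ, x ∈ Subgroup.zpowers ω) (hn : n ∣ orderOf ω)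
    (h1 : dlog ω n (-1) = 0) (β : Lˣ) :
    ∑ x : Lˣ, period ψ ω n (dlog ω n (normUnits K x)) *
        ψ (Algebra.trace K L ((β : L) * x)) =
      -(Fintype.card K : ℂ) * period ψ ω n (dlog ω n (normUnits K β)) -
        ((Fintype.card K : ℂ) - 1) / n := by
  simp_rw [period_dlog hω hn, Finset.sum_mul]
  rw [Finset.sum_comm]
  -- The subtracted 1 is the term at 0, present in the sum over L but absent from the sum over
  -- units.
  have h : ∀ u : Kˣ, ∑ x : Lˣ, (if dlog ω n u = 0 then ψ ((u : K) * normUnits K x) else 0) *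
      ψ (Algebra.trace K L ((β : L) * x)) =
      -(Fintype.card K : ℂ) * (if dlog ω n u = 0 then ψ ((-u⁻¹ : Kˣ) * normUnits K β) else 0) -
      (if dlog ω n u = 0 then 1 else 0) := by
    intro u
    split_ifs with hu
    · simp only [coe_normUnits]
      rw [sum_units_eq (fun x : L => ψ ((u : K) * Algebra.norm K x) *
        ψ (Algebra.trace K L ((β : L) * x))), sum_norm_mul_trace hQ hL hψ u.ne_zero]
      have hz : Algebra.norm K (0 : L) = 0 := by
        have : Nontrivial L := inferInstance
        exact Algebra.norm_zero
      simp only [hz, mul_zero, map_zero, AddChar.map_zero_eq_one, mul_one]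
      congr 3
      push_cast; ring
    · simp
  simp_rw [h]
  rw [Finset.sum_sub_distrib, ← Finset.mul_sum,
    sum_comp_dlog hω hn (fun j => if j = 0 then (1 : ℂ) else 0), Fintype.card_units]
  -- The substitution u ↦ −u⁻¹ preserves the class of logarithm 0, since −1 lies in it.
  have h2 : ∑ u : Kˣ, (if dlog ω n u = 0 then ψ ((-u⁻¹ : Kˣ) * normUnits K β) else 0) =
      ∑ u : Kˣ, if dlog ω n u = 0 then ψ ((u : K) * normUnits K β) else 0 := by
    refine Fintype.sum_equiv ((Equiv.inv Kˣ).trans (Equiv.neg Kˣ)) _ _ fun u => ?_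
    have : dlog ω n (-u⁻¹) = -dlog ω n u := by
      rw [neg_eq_neg_one_mul, dlog_mul hω hn, h1, dlog_inv hω hn, zero_add]
    simp [this]
  rw [h2, Nat.cast_sub Fintype.card_pos]
  simp

end Units

/-! ### The sign δ and functions on residues modulo 4. -/

section Signs

/-- The sign `δ` as a function on residue classes modulo `4`. -/
def deltaMod (N : ℕ) (j : ZMod 4) : ℂ :=
  if ((j = 0 ∨ j = 1) ∧ N % 4 = 1) ∨ ((j = 0 ∨ j = 3) ∧ N % 4 = 3) then 1 else -1

lemma delta_eq_deltaMod (N : ℕ) (a : ℤ) : delta N a = deltaMod N a := by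
  have h : (a : ZMod 4) = ((a % 4 : ℤ) : ZMod 4) := (ZMod.intCast_mod a 4).symm
  have h0 : (a : ZMod 4) = 0 ↔ a % 4 = 0 := by
    rw [ZMod.intCast_zmod_eq_zero_iff_dvd]; exact Int.dvd_iff_emod_eq_zero
  have h1 : (a : ZMod 4) = 1 ↔ a % 4 = 1 := by
    rw [← Int.cast_one, ZMod.intCast_eq_intCast_iff]; rfl
  have h3 : (a : ZMod 4) = 3 ↔ a % 4 = 3 := by
    rw [show (3 : ZMod 4) = ((3 : ℤ) : ZMod 4) from rfl, ZMod.intCast_eq_intCast_iff]; rfl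
  simp only [delta, deltaMod, h0, h1, h3]

lemma deltaMod_eq_one_or (N : ℕ) (j : ZMod 4) : deltaMod N j = 1 ∨ deltaMod N j = -1 := by
  unfold deltaMod; split_ifs <;> simp

/-- Translates the index pairs of Y_X into signs: Ni + 4j is Ni modulo 4, so i ∈ {0, 3} carries +1
and i ∈ {1, 2} carries −1. -/
lemma deltaMod_neg_mul {N : ℕ} (hN : Odd N) (i : ZMod 4) :
    deltaMod N (-(N * i)) = if i = 0 ∨ i = 3 then 1 else -1 := by
  have hN4 : N % 4 = 1 ∨ N % 4 = 3 := by obtain ⟨k, rfl⟩ := hN; omega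
  rw [← ZMod.natCast_mod N 4, deltaMod]
  rcases hN4 with h | h <;> simp only [h] <;> revert i <;> norm_num <;> intro i <;>
    congr 1 <;> revert i <;> decide

/-- The function `1, 0, -1, 0` on residue classes modulo `4`. -/
def cosMod (j : ZMod 4) : ℂ := if j = 0 then 1 else if j = 2 then -1 else 0

/-- δ changes sign under translation by 2. So the two terms cancel for odd x, and each is δ(a) for x
= 0 and −δ(a) for x = 2. -/
lemma deltaMod_sub_add_deltaMod_add {N : ℕ} (hN : Odd N) (a x : ZMod 4) :
    deltaMod N (a - x) + deltaMod N (a + x) = 2 * cosMod x * deltaMod N a := by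
  have hN4 : N % 4 = 1 ∨ N % 4 = 3 := by obtain ⟨k, rfl⟩ := hN; omega
  have hx : ∀ y : ZMod 4, y = 0 ∨ y = 1 ∨ y = 2 ∨ y = 3 := by decide
  have e : (0 : ZMod 4) ≠ 1 ∧ (0 : ZMod 4) ≠ 2 ∧ (0 : ZMod 4) ≠ 3 ∧ (1 : ZMod 4) ≠ 2 ∧
    (1 : ZMod 4) ≠ 3 ∧ (2 : ZMod 4) ≠ 3 ∧ (2 : ZMod 4) ≠ 0 ∧ (2 : ZMod 4) ≠ 1 ∧
    (3 : ZMod 4) ≠ 0 ∧ (3 : ZMod 4) ≠ 1 ∧ (3 : ZMod 4) ≠ 2 ∧ (1 : ZMod 4) ≠ 0 := by decide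
  have s : (0 - 1 : ZMod 4) = 3 ∧ (0 - 2 : ZMod 4) = 2 ∧ (0 - 3 : ZMod 4) = 1 ∧
    (1 - 1 : ZMod 4) = 0 ∧ (1 - 2 : ZMod 4) = 3 ∧ (1 - 3 : ZMod 4) = 2 ∧ (2 - 1 : ZMod 4) = 1 ∧
    (2 - 2 : ZMod 4) = 0 ∧ (2 - 3 : ZMod 4) = 3 ∧ (3 - 1 : ZMod 4) = 2 ∧ (3 - 2 : ZMod 4) = 1 ∧
    (3 - 3 : ZMod 4) = 0 ∧ (1 + 1 : ZMod 4) = 2 ∧ (1 + 2 : ZMod 4) = 3 ∧ (1 + 3 : ZMod 4) = 0 ∧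
    (2 + 1 : ZMod 4) = 3 ∧ (2 + 2 : ZMod 4) = 0 ∧ (2 + 3 : ZMod 4) = 1 ∧ (3 + 1 : ZMod 4) = 0 ∧
    (3 + 2 : ZMod 4) = 1 ∧ (3 + 3 : ZMod 4) = 2 := by decide
  obtain ⟨e1, e2, e3, e4, e5, e6, e7, e8, e9, e10, e11, e12⟩ := e
  obtain ⟨s1, s2, s3, s4, s5, s6, s7, s8, s9, s10, s11, s12, s13, s14, s15, s16, s17, s18, s19,
    s20, s21⟩ := s
  rcases hN4 with h | h <;> rcases hx a with rfl | rfl | rfl | rfl <;>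
    rcases hx x with rfl | rfl | rfl | rfl <;>
    simp only [deltaMod, cosMod, h, s1, s2, s3, s4, s5, s6, s7, s8, s9, s10, s11, s12, s13, s14,
      s15, s16, s17, s18, s19, s20, s21, e1, e2, e3, e4, e5, e6, e7, e8, e9, e10, e11, e12,
      sub_zero, add_zero, zero_add] <;> norm_num

lemma cosMod_two_mul (s : ℤ) : cosMod (2 * (s : ZMod 4)) = (-1 : ℂ) ^ s := by
  have h2 : (2 * (2 * (1 : ZMod 4))) = 0 := by decide
  obtain ⟨k, rfl | rfl⟩ := Int.even_or_odd' s
  · have : 2 * ((2 * k : ℤ) : ZMod 4) = 0 := by push_cast; linear_combination (k : ZMod 4) * h2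
    rw [this, Even.neg_one_zpow (even_two_mul k)]; simp [cosMod]
  · have : 2 * ((2 * k + 1 : ℤ) : ZMod 4) = 2 := by push_cast; linear_combination (k : ZMod 4) * h2
    rw [this, Odd.neg_one_zpow (odd_two_mul_add_one k)]
    have : (2 : ZMod 4) ≠ 0 := by decide
    simp [cosMod, this]

end Signs

/-! ### Values of the quadratic character at powers of a generator. -/

section Generator

variable {K : Type*} [Field K] [Fintype K] {ω : Kˣ}

lemma quadChar_generator (hQ : Fintype.card K % 4 = 3) (hω : ∀ x : Kˣ, x ∈ Subgroup.zpowers ω) :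
    quadChar K ω = -1 := by
  have h : (quadChar K ω - 1) * (quadChar K ω + 1) = 0 := by
    linear_combination quadChar_mul_self ω.ne_zero
  rcases mul_eq_zero.mp h with h | h
  -- If η(ω) = 1 then η is trivial on all units, contradicting η(−1) = −1.
  · exfalso
    obtain ⟨s, hs⟩ := hω (-1)
    have h1 : quadChar K (ω ^ s : Kˣ) = quadChar K (-1 : Kˣ) :=
      congrArg (fun u : Kˣ => quadChar K u) hs
    have h2 := quadChar_neg_one hQ
    have h3 : MulChar.toUnitHom (quadChar K) ω = 1 := by
      ext; rw [MulChar.coe_toUnitHom, sub_eq_zero.mp h]; rfl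
    rw [← MulChar.coe_toUnitHom, map_zpow, h3, one_zpow, Units.val_one, Units.val_neg,
      Units.val_one, h2] at h1
    norm_num at h1
  · linear_combination h

lemma quadChar_generator_zpow (hQ : Fintype.card K % 4 = 3)
    (hω : ∀ x : Kˣ, x ∈ Subgroup.zpowers ω) (s : ℤ) :
    quadChar K (ω ^ s : Kˣ) = (-1) ^ s := by
  rw [← MulChar.coe_toUnitHom, map_zpow, Units.val_zpow_eq_zpow_val, MulChar.coe_toUnitHom,
    quadChar_generator hQ hω]

/-- `cosMod` of the logarithm vanishes at odd exponents, that is, at nonsquares; on squares 1 + η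
equals 2. -/
lemma cosMod_mul_one_add_quadChar {γ : Kˣ} (hγ : ∀ x : Kˣ, x ∈ Subgroup.zpowers γ)
    (h4 : 4 ∣ orderOf γ) (x : Kˣ) :
    (1 + quadChar K x) * cosMod (dlog γ 4 x) = 2 * cosMod (dlog γ 4 x) := by
  obtain ⟨s, rfl⟩ := hγ x
  dsimp only
  rw [dlog_zpow h4]
  obtain ⟨k, rfl | rfl⟩ := Int.even_or_odd' s
  · have h : ((γ ^ (2 * k) : Kˣ) : K) = ((γ ^ k : Kˣ) : K) ^ 2 := by
      rw [← Units.val_pow_eq_pow_val, ← zpow_natCast, ← zpow_mul, mul_comm]; rfl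
    rw [h, quadChar_sq (Units.ne_zero _)]; ring
  · have h : cosMod ((2 * k + 1 : ℤ) : ZMod 4) = 0 := by
      push_cast
      have : ∀ j : ZMod 4, 2 * j + 1 ≠ 0 ∧ 2 * j + 1 ≠ 2 := by decide
      simp [cosMod, this]
    rw [h]; simp

end Generator

/-! ### Evaluation of the part of the character sum carrying the sign δ. -/

section SalieSum

variable {K L : Type*} [Field K] [Fintype K] [Field L] [Fintype L] [Algebra K L]
  {ψ : AddChar K ℂ} {ω : Kˣ} {γ : Lˣ} {N : ℕ}

open scoped Classical

omit [Fintype L] in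
lemma normUnits_pow_card (x : Lˣ) : normUnits K (x ^ Fintype.card K) = normUnits K x := by
  rw [map_pow]; ext; rw [Units.val_pow_eq_pow_val, FiniteField.pow_card]

omit [Field K] [Algebra K L] in
lemma involutive_pow_card (hL : Fintype.card L = Fintype.card K ^ 2) :
    Function.Involutive (fun x : Lˣ => x ^ Fintype.card K) := fun x => by
  ext
  simp only [← pow_mul, ← sq, ← hL, Units.val_pow_eq_pow_val, FiniteField.pow_card]

omit [Fintype K] [Fintype L] in
lemma dlog_normUnits (hγω : normUnits K γ = ω) (hω : N ∣ orderOf ω) (s : ℤ) :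
    dlog ω N (normUnits K (γ ^ s)) = s := by
  rw [map_zpow, hγω, dlog_zpow hω]

omit [Field K] [Fintype L] [Algebra K L] in
lemma dlog_four_pow_card (hQ : Fintype.card K % 4 = 3) (hγ : ∀ x : Lˣ, x ∈ Subgroup.zpowers γ)
    (h4 : 4 ∣ orderOf γ) (x : Lˣ) : dlog γ 4 (x ^ Fintype.card K) = -dlog γ 4 x := by
  rw [dlog_pow hγ h4, ← ZMod.natCast_mod, hQ]
  generalize dlog γ 4 x = j
  revert j; decide

-- For w = γ^s both sides equal (−1)^s, because the norm of w is ω^s.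
omit [Fintype L] in
lemma quadChar_normUnits (hQ : Fintype.card K % 4 = 3) (hω : ∀ x : Kˣ, x ∈ Subgroup.zpowers ω)
    (hγ : ∀ x : Lˣ, x ∈ Subgroup.zpowers γ) (h4 : 4 ∣ orderOf γ) (hγω : normUnits K γ = ω)
    (w : Lˣ) : cosMod (dlog γ 4 (w ^ 2)) = quadChar K (normUnits K w) := by
  rw [dlog_pow hγ h4]
  obtain ⟨s, rfl⟩ := hγ w
  dsimp only
  rw [dlog_zpow h4, map_zpow, hγω, quadChar_generator_zpow hQ hω, ← cosMod_two_mul]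
  rfl

/-- The part of the character sum which is not invariant under the quartic character. -/
lemma sum_deltaMod (hQ : Fintype.card K % 4 = 3) (hL : Fintype.card L = Fintype.card K ^ 2)
    (hψ : ψ.IsPrimitive) (hω : ∀ x : Kˣ, x ∈ Subgroup.zpowers ω)
    (hγ : ∀ x : Lˣ, x ∈ Subgroup.zpowers γ) (h4 : 4 ∣ orderOf γ) (hγω : normUnits K γ = ω)
    (hN : Odd N) (hNω : N ∣ orderOf ω) (hneg : dlog ω N (-1) = 0) (h : ZMod N → ℂ) (a : ℤ) :
    ∑ x : Lˣ, h (dlog ω N (normUnits K x)) * deltaMod N (-dlog γ 4 x) *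
        ψ (Algebra.trace K L (((γ ^ a : Lˣ) : L) * x)) =
      -deltaMod N a * quadGaussSum ψ *
        ∑ n : Kˣ, quadChar K n * h (2 * dlog ω N n - a) * ψ (2 * n) := by
  set f : Lˣ → ℂ := fun x => h (dlog ω N (normUnits K x) - a) *
    ψ (Algebra.trace K L (x : L)) with hf
  -- Translation by γ^a moves a from the additive character into both logarithms.
  have e1 : ∑ x : Lˣ, h (dlog ω N (normUnits K x)) * deltaMod N (-dlog γ 4 x) *
      ψ (Algebra.trace K L (((γ ^ a : Lˣ) : L) * x)) =
      ∑ x : Lˣ, deltaMod N (a - dlog γ 4 x) * f x := by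
    refine Fintype.sum_equiv (Equiv.mulLeft (γ ^ a)) _ _ fun x => ?_
    simp only [hf, Equiv.coe_mulLeft, map_mul, dlog_mul hω hNω, dlog_mul hγ h4, dlog_zpow h4,
      dlog_normUnits hγω hNω, add_sub_cancel_left, sub_add_cancel_left, Units.val_mul]
    ring
  -- Frobenius fixes norm and trace and negates the logarithm modulo 4.
  have e2 : ∑ x : Lˣ, deltaMod N (a - dlog γ 4 x) * f x =
      ∑ x : Lˣ, deltaMod N (a + dlog γ 4 x) * f x := by
    refine Fintype.sum_equiv (involutive_pow_card hL).toPerm _ _ fun x => ?_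
    simp only [hf, Function.Involutive.coe_toPerm, dlog_four_pow_card hQ hγ h4,
      normUnits_pow_card, Units.val_pow_eq_pow_val, trace_pow_card hL, sub_eq_add_neg]
  have e3 : ∑ x : Lˣ, deltaMod N (a - dlog γ 4 x) * f x =
      deltaMod N a * ∑ x : Lˣ, cosMod (dlog γ 4 x) * f x := by
    have : 2 * ∑ x : Lˣ, deltaMod N (a - dlog γ 4 x) * f x =
        2 * (deltaMod N a * ∑ x : Lˣ, cosMod (dlog γ 4 x) * f x) := by
      nth_rewrite 1 [two_mul]
      nth_rewrite 2 [e2]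
      rw [← Finset.sum_add_distrib, Finset.mul_sum, Finset.mul_sum]
      refine Finset.sum_congr rfl fun x _ => ?_
      rw [← add_mul, deltaMod_sub_add_deltaMod_add hN]; ring
    exact mul_left_cancel₀ two_ne_zero this
  have hF : ringChar L ≠ 2 := by
    intro h2
    have := FiniteField.even_card_of_char_two h2
    have h3 : Fintype.card K % 2 = 1 := by omega
    rw [hL, Nat.pow_mod, h3] at this
    norm_num at this
  -- Substituting x = w² loses nothing, as `cosMod` lives on squares; the factor ½ accounts for the
  -- two roots.
  have e4 : ∑ x : Lˣ, cosMod (dlog γ 4 x) * f x =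
      1 / 2 * ∑ w : Lˣ, quadChar K (normUnits K w) * f (w ^ 2) := by
    have := sum_units_comp_sq hF (fun x => cosMod (dlog γ 4 x) * f x)
    simp only [quadChar_normUnits hQ hω hγ h4 hγω, ← mul_assoc,
      cosMod_mul_one_add_quadChar hγ h4] at this
    rw [this, Finset.mul_sum]
    exact Finset.sum_congr rfl fun x _ => by ring
  set B : K → ℂ := extendZero (fun n => quadChar K n * h (2 * dlog ω N n - a)) with hBdef
  -- η is odd, while n and −n have the same logarithm modulo N.
  have hB : ∀ n, B (-n) = -B n := by
    intro n
    by_cases hn : n = 0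
    · simp [hn, hBdef]
    · lift n to Kˣ using IsUnit.mk0 n hn
      rw [hBdef, ← Units.val_neg, extendZero_coe, extendZero_coe, Units.val_neg, quadChar_neg hQ,
        neg_eq_neg_one_mul (n : Kˣ), dlog_mul hω hNω, hneg, zero_add, neg_mul]
  have e5 : ∑ w : Lˣ, quadChar K (normUnits K w) * f (w ^ 2) =
      ∑ z : L, B (Algebra.norm K z) * ψ (Algebra.trace K L (z ^ 2)) := by
    have hz : Algebra.norm K (0 : L) = 0 := Algebra.norm_zero
    have := sum_units_eq (fun z : L => B (Algebra.norm K z) * ψ (Algebra.trace K L (z ^ 2)))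
    simp only [← coe_normUnits, hz, hBdef, extendZero_zero, extendZero_coe, zero_mul,
      sub_zero] at this
    rw [hBdef, ← this]
    refine Finset.sum_congr rfl fun w _ => ?_
    simp only [hf, map_pow, dlog_pow hω hNω, Units.val_pow_eq_pow_val]
    push_cast; ring
  have e6 : ∑ n : K, B n * ψ (2 * n) =
      ∑ n : Kˣ, quadChar K n * h (2 * dlog ω N n - a) * ψ (2 * n) := by
    have := sum_units_eq (fun n : K => B n * ψ (2 * n))
    simp only [hBdef, extendZero_zero, extendZero_coe, zero_mul, sub_zero] at this
    rw [this, hBdef]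
  rw [e1, e3, e4, e5, sum_odd_norm_mul_trace_sq hQ hL hψ hB, e6]
  ring

/-- Substitute n ↦ ω^(−c)·2·n in the sum on the right. The relation 2c = a produces the shift of the
logarithm, 2 has logarithm 0 modulo N, and evenness of c leaves η(2) as the only new sign. -/
lemma sum_quadChar_dlog (hQ : Fintype.card K % 4 = 3)
    (hω : ∀ x : Kˣ, x ∈ Subgroup.zpowers ω) (hNω : N ∣ orderOf ω) (t : Kˣ) (ht : (t : K) = 2)
    (htwo : dlog ω N t = 0) (h : ZMod N → ℂ) {a c : ℤ} (hc : Even c)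
    (hca : (2 * c : ZMod N) = a) :
    ∑ n : Kˣ, quadChar K n * h (2 * dlog ω N n - a) * ψ (2 * n) =
      quadChar K 2 * ∑ n : Kˣ, quadChar K n * h (2 * dlog ω N n) * ψ ((ω ^ c : Kˣ) * n) := by
  rw [Finset.mul_sum]
  refine Fintype.sum_equiv (Equiv.mulLeft (ω ^ (-c) * t)) _ _ fun n => ?_
  have h2 := quadChar_mul_self (two_ne_zero_of_card hQ)
  have h1 : 2 * dlog ω N (ω ^ (-c) * t * n) = 2 * dlog ω N n - a := by
    rw [dlog_mul hω hNω, dlog_mul hω hNω, htwo, dlog_zpow hNω, ← hca]; push_cast; ring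
  have h3 : ((ω ^ c : Kˣ) : K) * (ω ^ (-c) * t * n : Kˣ) = 2 * n := by
    rw [← Units.val_mul, ← mul_assoc, ← mul_assoc, ← zpow_add, add_neg_cancel, zpow_zero, one_mul,
      Units.val_mul, ht]
  rw [Equiv.coe_mulLeft, h1, h3, Units.val_mul, Units.val_mul, map_mul (quadChar K),
    map_mul (quadChar K), ht, quadChar_generator_zpow hQ hω, hc.neg.neg_one_zpow]
  linear_combination -quadChar K n * h (2 * dlog ω N n - a) * ψ (2 * n) * h2

end SalieSum

/-! ### Membership in X and Y_X in terms of the exponent. -/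

section IndexSets

variable {N : ℕ}

lemma mem_halve (hN : Odd N) {I : Set (ZMod N)} {j : ZMod N} : j ∈ halve I ↔ 2 * j ∈ I := by
  have h : ((2 : ℕ) : ZMod N) * ((2 : ℕ) : ZMod N)⁻¹ = 1 :=
    ZMod.coe_mul_inv_eq_one 2 hN.coprime_two_left
  push_cast at h
  constructor
  · rintro ⟨s, hs, rfl⟩
    dsimp only
    rwa [← mul_assoc, h, one_mul]
  · intro hj
    exact ⟨2 * j, hj, by linear_combination j * h⟩

lemma intCast_eq_of_modEq {n k : ℕ} (hk : k ∣ n) {s t : ℤ} (h : (s : ZMod n) = (t : ZMod n)) :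
    (s : ZMod k) = t := by
  rw [ZMod.intCast_eq_intCast_iff] at h ⊢
  exact h.of_dvd (by exact_mod_cast hk)

/-- As N is odd, 2j is even and 2j + N is odd: the parity of the exponent separates the two parts of
X. -/
lemma intCast_mem_indexX (hN : Odd N) {S₁ S₂ : Set (ZMod N)} (s : ℤ) :
    (s : ZMod (2 * N)) ∈ indexX N S₁ S₂ ↔
      (Even s ∧ 2 * (s : ZMod N) ∈ S₁) ∨ (Odd s ∧ 2 * (s : ZMod N) ∈ S₂) := by
  have hN' : Odd (N : ℤ) := by exact_mod_cast hN
  have hpar : ∀ t : ℤ, (s : ZMod (2 * N)) = (t : ZMod (2 * N)) → (Even s ↔ Even t) := by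
    intro t h
    have := intCast_eq_of_modEq (Dvd.intro N rfl) h
    rw [ZMod.intCast_eq_intCast_iff_dvd_sub] at this
    have h2 : Even (t - s) := even_iff_two_dvd.mpr (by exact_mod_cast this)
    rw [Int.even_sub] at h2
    exact h2.symm
  have hmod : ∀ t : ℤ, (s : ZMod (2 * N)) = (t : ZMod (2 * N)) → (s : ZMod N) = t :=
    fun t h => intCast_eq_of_modEq (Dvd.intro_left 2 rfl) h
  simp only [indexX, Set.mem_union, Set.mem_ofPred_eq, mem_halve hN]
  constructor
  · rintro (⟨j, hj, h⟩ | ⟨j, hj, h⟩)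
    · left
      rw [hpar _ h, hmod _ h]
      refine ⟨even_two_mul j, ?_⟩
      push_cast; exact hj
    · right
      rw [← Int.not_even_iff_odd, hpar _ h, hmod _ h, Int.not_even_iff_odd]
      refine ⟨(even_two_mul j).add_odd hN', ?_⟩
      push_cast
      rw [ZMod.natCast_self, add_zero]; exact hj
  · rintro (⟨⟨j, rfl⟩, h⟩ | ⟨hs, h⟩)
    · left
      refine ⟨j, ?_, by rw [Int.two_mul]⟩
      push_cast at h
      rwa [← two_mul] at h
    · right
      obtain ⟨j, hj⟩ := hs.sub_odd hN'
      have hs' : s = 2 * j + N := by linear_combination hj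
      refine ⟨j, ?_, by rw [hs']⟩
      rw [hs'] at h
      push_cast at h
      rwa [ZMod.natCast_self, add_zero] at h

lemma intCast_mem_indexY (hN : Odd N) {I₁ S₁ S₂ : Set (ZMod N)} (s : ℤ) :
    (s : ZMod (4 * N)) ∈ indexY N I₁ S₁ S₂ ↔
      ((s : ZMod N) ∈ S₁ ∧ deltaMod N (-(s : ZMod 4)) = 1) ∨
      ((s : ZMod N) ∈ S₂ ∧ deltaMod N (-(s : ZMod 4)) = -1) ∨ (s : ZMod N) ∈ I₁ := by
  have hmem : ∀ (j : ℤ) (I : Set (ZMod N)),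
      (j : ZMod N) ∈ halve (halve I) ↔ 4 * (j : ZMod N) ∈ I := by
    intro j I
    rw [mem_halve hN, mem_halve hN, ← mul_assoc]; norm_num
  have h03 : ∀ i : ℤ, i ∈ ({0, 3} : Set ℤ) → deltaMod N (-(N * (i : ZMod 4))) = 1 := by
    rintro i (rfl | rfl) <;> rw [deltaMod_neg_mul hN, if_pos] <;> decide
  have h12 : ∀ i : ℤ, i ∈ ({1, 2} : Set ℤ) → deltaMod N (-(N * (i : ZMod 4))) = -1 := by
    rintro i (rfl | rfl) <;> rw [deltaMod_neg_mul hN, if_neg] <;> decide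
  have h4 : (4 : ZMod 4) = 0 := by decide
  simp only [indexY, Set.mem_ofPred_eq, hmem]
  constructor
  · rintro ⟨i, j, h, hs⟩
    have e1 : (s : ZMod N) = 4 * j := by
      rw [intCast_eq_of_modEq (Dvd.intro_left 4 rfl) hs]; push_cast; simp
    have e2 : (s : ZMod 4) = N * i := by
      rw [intCast_eq_of_modEq (Dvd.intro N rfl) hs]; push_cast; rw [h4]; ring
    rw [e1, e2]
    rcases h with ⟨hi, hj⟩ | ⟨hi, hj⟩ | ⟨hi, hj⟩
    · exact Or.inl ⟨hj, h03 i hi⟩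
    · exact Or.inr (Or.inl ⟨hj, h12 i hi⟩)
    · exact Or.inr (Or.inr hj)
  · intro h
    -- N is a unit modulo 4, so every residue modulo 4 is some Ni.
    obtain ⟨i, hi, hsi⟩ : ∃ i : ℤ, i ∈ ({0, 1, 2, 3} : Set ℤ) ∧ (s : ZMod 4) = N * i := by
      have hu : ∀ n t : ZMod 4, (n = 1 ∨ n = 3) →
          t = n * ((0 : ℤ) : ZMod 4) ∨ t = n * ((1 : ℤ) : ZMod 4) ∨
            t = n * ((2 : ℤ) : ZMod 4) ∨ t = n * ((3 : ℤ) : ZMod 4) := by decide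
      have hN4 : (N : ZMod 4) = 1 ∨ (N : ZMod 4) = 3 := by
        have : N % 4 = 1 ∨ N % 4 = 3 := by obtain ⟨k, rfl⟩ := hN; omega
        rw [← ZMod.natCast_mod N 4]
        rcases this with h | h <;> rw [h] <;> simp
      rcases hu N s hN4 with h | h | h | h
      exacts [⟨0, by simp, h⟩, ⟨1, by simp, h⟩, ⟨2, by simp, h⟩, ⟨3, by simp, h⟩]
    have hdvd : (4 : ℤ) ∣ s - N * i := by
      refine (ZMod.intCast_zmod_eq_zero_iff_dvd _ 4).mp ?_
      push_cast; rw [hsi]; ring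
    obtain ⟨j, hj⟩ := hdvd
    have hs : s = N * i + 4 * j := by linear_combination hj
    have e1 : (s : ZMod N) = 4 * j := by rw [hs]; push_cast; simp
    refine ⟨i, j, ?_, by rw [hs]⟩
    rw [e1, hsi] at h
    have hi' : i ∈ ({0, 3} : Set ℤ) ∨ i ∈ ({1, 2} : Set ℤ) := by
      simp only [Set.mem_insert_iff, Set.mem_singleton_iff] at hi ⊢; tauto
    rcases h with ⟨h, hd⟩ | ⟨h, hd⟩ | h
    · rcases hi' with h' | h'
      · exact Or.inl ⟨h', h⟩
      · rw [h12 i h'] at hd; norm_num at hd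
    · rcases hi' with h' | h'
      · rw [h03 i h'] at hd; norm_num at hd
      · exact Or.inr (Or.inl ⟨h', h⟩)
    · exact Or.inr (Or.inr ⟨hi, h⟩)

open Classical in
/-- The indicator function of a set. -/
def ind {α : Type*} (S : Set α) (x : α) : ℂ := if x ∈ S then 1 else 0

lemma ind_of_mem {α : Type*} {S : Set α} {x : α} (h : x ∈ S) : ind S x = 1 := if_pos h

lemma ind_of_notMem {α : Type*} {S : Set α} {x : α} (h : x ∉ S) : ind S x = 0 := if_neg h

lemma sum_ind {α : Type*} [Fintype α] (S : Set α) : ∑ x, ind S x = S.ncard := by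
  classical
  simp only [ind]
  rw [Finset.sum_boole, Set.ncard_eq_toFinset_card']
  congr 2
  ext; simp

end IndexSets

/-! ### The nontrivial character values of D. -/

section CharacterValues

variable {K L : Type*} [Field K] [Fintype K] [Field L] [Fintype L] [Algebra K L]
  {ψ : AddChar K ℂ} {Ψ : AddChar L ℂ} {ω : Kˣ} {γ : Lˣ} {N : ℕ}

open scoped Classical

lemma orderOf_generator (hω : ∀ x : Kˣ, x ∈ Subgroup.zpowers ω) :
    orderOf ω = Fintype.card K - 1 := by
  rw [orderOf_eq_card_of_forall_mem_zpowers hω, Nat.card_units, Nat.card_eq_fintype_card]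

lemma two_mul_dvd_orderOf (hQ : Fintype.card K % 4 = 3) (hω : ∀ x : Kˣ, x ∈ Subgroup.zpowers ω)
    (hN : Odd N) (hNω : N ∣ orderOf ω) : 2 * N ∣ orderOf ω := by
  refine Nat.Coprime.mul_dvd_of_dvd_of_dvd hN.coprime_two_left ?_ hNω
  rw [orderOf_generator hω]; omega

omit [Algebra K L] in
lemma four_mul_dvd_orderOf (hQ : Fintype.card K % 4 = 3)
    (hL : Fintype.card L = Fintype.card K ^ 2) (hω : ∀ x : Kˣ, x ∈ Subgroup.zpowers ω)
    (hγ : ∀ x : Lˣ, x ∈ Subgroup.zpowers γ) (hN : Odd N) (hNω : N ∣ orderOf ω) :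
    4 * N ∣ orderOf γ := by
  have h4 : Nat.Coprime 4 N := by
    have : (4 : ℕ) = 2 ^ 2 := rfl
    rw [this]; exact (hN.coprime_two_left).pow_left 2
  have hfac : orderOf γ = (Fintype.card K + 1) * (Fintype.card K - 1) := by
    rw [orderOf_generator hγ, hL]
    simpa using Nat.sq_sub_sq (Fintype.card K) 1
  rw [hfac]
  refine Nat.mul_dvd_mul ?_ ?_
  · omega
  · rwa [← orderOf_generator hω]

-- On S₁ membership in D means δ = 1, on S₂ it means δ = −1, so there the indicator is (1 ± δ)/2. On
-- I₁ it is 1 whatever δ.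
omit [Fintype K] [Fintype L] in
lemma ind_connectionSet (hγ : ∀ x : Lˣ, x ∈ Subgroup.zpowers γ) (hN : Odd N)
    (hNω : N ∣ orderOf ω) (hNγ : 4 * N ∣ orderOf γ) (hγω : normUnits K γ = ω)
    {I₁ I₂ S₁ S₂ : Set (ZMod N)} (hI : Disjoint I₁ I₂) (hSunion : S₁ ∪ S₂ = I₂)
    (hSdisj : Disjoint S₁ S₂) (x : Lˣ) :
    ind (connectionSet γ N I₁ S₁ S₂) (x : L) =
      (ind I₁ (dlog ω N (normUnits K x)) + 1 / 2 * ind I₂ (dlog ω N (normUnits K x))) +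
      1 / 2 * ((ind S₁ (dlog ω N (normUnits K x)) - ind S₂ (dlog ω N (normUnits K x))) *
        deltaMod N (-dlog γ 4 x)) := by
  obtain ⟨s, rfl⟩ := hγ x
  dsimp only
  rw [dlog_normUnits hγω hNω, dlog_zpow ((Dvd.intro N rfl).trans hNγ)]
  have hmem : ((γ ^ s : Lˣ) : L) ∈ connectionSet γ N I₁ S₁ S₂ ↔ _ :=
    (coe_mem_cyclotomicUnion hγ hNγ).trans (by rw [dlog_zpow hNγ, intCast_mem_indexY hN])
  have h2 : (s : ZMod N) ∈ I₂ ↔ (s : ZMod N) ∈ S₁ ∨ (s : ZMod N) ∈ S₂ := by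
    rw [← hSunion]; rfl
  have hd : ¬ ((s : ZMod N) ∈ S₁ ∧ (s : ZMod N) ∈ S₂) :=
    fun h => Set.disjoint_left.mp hSdisj h.1 h.2
  have hd' : ¬ ((s : ZMod N) ∈ I₁ ∧ ((s : ZMod N) ∈ S₁ ∨ (s : ZMod N) ∈ S₂)) :=
    fun h => Set.disjoint_left.mp hI h.1 (h2.mpr h.2)
  simp only [ind, hmem, h2]
  have hm : (-1 : ℂ) ≠ 1 := by norm_num
  rcases deltaMod_eq_one_or N (-(s : ZMod 4)) with h | h <;> rw [h] <;>
    by_cases h1 : (s : ZMod N) ∈ S₁ <;> by_cases h3 : (s : ZMod N) ∈ S₂ <;>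
    by_cases h4 : (s : ZMod N) ∈ I₁ <;> simp [h1, h3, h4, hm, hm.symm] at hd hd' ⊢ <;> norm_num

/-- At ω^s, twice the indicator of X minus that of 2⁻¹I₂ is (1_{S₁} − 1_{S₂})(2s) for even s and its
negative for odd s, and this sign is η. -/
lemma bracket_eq (hQ : Fintype.card K % 4 = 3) (hω : ∀ x : Kˣ, x ∈ Subgroup.zpowers ω)
    (hN : Odd N) (hNω : N ∣ orderOf ω) {I₂ S₁ S₂ : Set (ZMod N)} (hSunion : S₁ ∪ S₂ = I₂)
    (hSdisj : Disjoint S₁ S₂) (c : ℤ) :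
    bracket ψ ω N I₂ S₁ S₂ c = ∑ x : Kˣ, quadChar K x *
      (ind S₁ (2 * dlog ω N x) - ind S₂ (2 * dlog ω N x)) * ψ ((ω ^ c : Kˣ) * x) := by
  have h2N := two_mul_dvd_orderOf hQ hω hN hNω
  rw [bracket, charSum_smul ψ zero_notMem_cyclotomicUnion,
    charSum_smul ψ zero_notMem_cyclotomicUnion, Finset.mul_sum, ← Finset.sum_sub_distrib]
  refine Finset.sum_congr rfl fun x _ => ?_
  rw [coe_mem_cyclotomicUnion hω h2N, coe_mem_cyclotomicUnion hω hNω]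
  obtain ⟨s, rfl⟩ := hω x
  dsimp only
  rw [dlog_zpow h2N, dlog_zpow hNω, mem_halve hN, intCast_mem_indexX hN,
    quadChar_generator_zpow hQ hω]
  have h2 : 2 * (s : ZMod N) ∈ I₂ ↔ 2 * (s : ZMod N) ∈ S₁ ∨ 2 * (s : ZMod N) ∈ S₂ := by
    rw [← hSunion]; rfl
  have hd : ¬ (2 * (s : ZMod N) ∈ S₁ ∧ 2 * (s : ZMod N) ∈ S₂) :=
    fun h => Set.disjoint_left.mp hSdisj h.1 h.2
  simp only [h2, ind]
  rcases Int.even_or_odd s with h | h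
  · have h' : ¬ Odd s := Int.not_odd_iff_even.mpr h
    rw [h.neg_one_zpow]
    by_cases h1 : 2 * (s : ZMod N) ∈ S₁ <;> by_cases h3 : 2 * (s : ZMod N) ∈ S₂ <;>
      simp [h, h', h1, h3] at hd ⊢ <;> ring
  · have h' : ¬ Even s := Int.not_even_iff_odd.mpr h
    rw [h.neg_one_zpow]
    by_cases h1 : 2 * (s : ZMod N) ∈ S₁ <;> by_cases h3 : 2 * (s : ZMod N) ∈ S₂ <;>
      simp [h, h', h1, h3] at hd ⊢ <;> ring

lemma dlog_neg_one (hQ : Fintype.card K % 4 = 3) (hω : ∀ x : Kˣ, x ∈ Subgroup.zpowers ω)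
    (hN : Odd N) (hNω : N ∣ orderOf ω) : dlog ω N (-1) = 0 :=
  dlog_eq_zero_of_pow_eq_one hω (k := 2) (by rw [mul_comm]; exact two_mul_dvd_orderOf hQ hω hN hNω)
    two_ne_zero (by simp)

/-- Character sums of functions of the norm which are affine in the Gauss periods. -/
lemma sum_affine_period [NeZero N] (hQ : Fintype.card K % 4 = 3)
    (hL : Fintype.card L = Fintype.card K ^ 2)
    (hψ : ψ.IsPrimitive) (hΨ : ∀ x, Ψ x = ψ (Algebra.trace K L x)) (hΨ' : Ψ.IsPrimitive)
    (hω : ∀ x : Kˣ, x ∈ Subgroup.zpowers ω)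
    (hγω : normUnits K γ = ω) (hN : Odd N) (hNω : N ∣ orderOf ω) {A C : ℂ} {f : ZMod N → ℂ}
    (hf : ∀ j, f j = A + C * period ψ ω N j) (a : ℤ) :
    ∑ x : Lˣ, f (dlog ω N (normUnits K x)) * Ψ (((γ ^ a : Lˣ) : L) * x) =
      ((Fintype.card K : ℂ) - 1) / N * ∑ j, f j - Fintype.card K * f a := by
  have h0 : ∑ x : Lˣ, Ψ (((γ ^ a : Lˣ) : L) * x) = -1 := by
    rw [← sum_units_addChar hΨ']
    exact Equiv.sum_comp (Equiv.mulLeft (γ ^ a)) (fun x : Lˣ => Ψ (x : L))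
  have h1 := sum_period_norm hQ hL hψ hω hNω (dlog_neg_one hQ hω hN hNω) (γ ^ a)
  rw [dlog_normUnits hγω hNω] at h1
  simp only [← hΨ] at h1
  simp only [hf, add_mul, Finset.sum_add_distrib, mul_assoc, ← Finset.mul_sum]
  rw [h0, h1, sum_period hψ]
  simp only [Finset.sum_const, Finset.card_univ, ZMod.card, nsmul_eq_mul]
  have hN0 : (N : ℂ) ≠ 0 := NeZero.ne _
  field_simp
  ring

omit [Fintype L] in
lemma zero_notMem_connectionSet {I₁ S₁ S₂ : Set (ZMod N)} :
    (0 : L) ∉ connectionSet γ N I₁ S₁ S₂ := zero_notMem_cyclotomicUnion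

lemma charSum_smul_connectionSet [NeZero N] (hQ : Fintype.card K % 4 = 3)
    (hL : Fintype.card L = Fintype.card K ^ 2)
    (hψ : ψ.IsPrimitive) (hΨ : ∀ x, Ψ x = ψ (Algebra.trace K L x)) (hΨ' : Ψ.IsPrimitive)
    (hω : ∀ x : Kˣ, x ∈ Subgroup.zpowers ω) (hγ : ∀ x : Lˣ, x ∈ Subgroup.zpowers γ)
    (hγω : normUnits K γ = ω) (hN : Odd N) (hNω : N ∣ orderOf ω)
    (t : Kˣ) (ht : (t : K) = 2) (htwo : dlog ω N t = 0) {A C : ℂ}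
    {I₁ I₂ S₁ S₂ : Set (ZMod N)} (hI : Disjoint I₁ I₂) (hSunion : S₁ ∪ S₂ = I₂)
    (hSdisj : Disjoint S₁ S₂)
    (hf : ∀ j, ind I₁ j + 1 / 2 * ind I₂ j = A + C * period ψ ω N j) {a c : ℤ} (hc : Even c)
    (hca : (2 * c : ZMod N) = a) :
    charSum Ψ (γ ^ a • connectionSet γ N I₁ S₁ S₂) =
      rho (Fintype.card K) * delta N a * (Fintype.card K : ℂ) / (2 * quadGaussSum ψ) *
          bracket ψ ω N I₂ S₁ S₂ c +
        ((Fintype.card K : ℂ) - 1) * (2 * (I₁.ncard : ℂ) + (I₂.ncard : ℂ)) / (2 * (N : ℂ)) -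
        Fintype.card K * (ind I₁ (a : ZMod N) + 1 / 2 * ind I₂ (a : ZMod N)) := by
  have hNγ := four_mul_dvd_orderOf hQ hL hω hγ hN hNω
  have h4 : 4 ∣ orderOf γ := (Dvd.intro N rfl).trans hNγ
  rw [charSum_smul Ψ zero_notMem_connectionSet]
  have e1 : ∀ x : Lˣ, (if (x : L) ∈ connectionSet γ N I₁ S₁ S₂ then
      Ψ (((γ ^ a : Lˣ) : L) * x) else 0) =
      (ind I₁ (dlog ω N (normUnits K x)) + 1 / 2 * ind I₂ (dlog ω N (normUnits K x))) *
        Ψ (((γ ^ a : Lˣ) : L) * x) + 1 / 2 *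
      ((ind S₁ (dlog ω N (normUnits K x)) - ind S₂ (dlog ω N (normUnits K x))) *
        deltaMod N (-dlog γ 4 x) * ψ (Algebra.trace K L (((γ ^ a : Lˣ) : L) * x))) := by
    intro x
    have := ind_connectionSet hγ hN hNω hNγ hγω hI hSunion hSdisj x
    rw [← hΨ, ← mul_assoc (1 / 2 : ℂ), ← add_mul, ← this, ind, ite_mul, one_mul, zero_mul]
  simp_rw [e1]
  rw [Finset.sum_add_distrib, ← Finset.mul_sum,
    sum_affine_period hQ hL hψ hΨ hΨ' hω hγω hN hNω hf a,
    sum_deltaMod hQ hL hψ hω hγ h4 hγω hN hNω (dlog_neg_one hQ hω hN hNω)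
      (fun j => ind S₁ j - ind S₂ j) a,
    sum_quadChar_dlog hQ hω hNω t ht htwo (fun j => ind S₁ j - ind S₂ j) hc hca,
    bracket_eq hQ hω hN hNω hSunion hSdisj, ← delta_eq_deltaMod, quadChar_two hQ,
    Finset.sum_add_distrib, ← Finset.mul_sum, sum_ind, sum_ind]
  have hG := quadGaussSum_ne_zero hQ hψ
  have hG2 := quadGaussSum_sq hQ hψ
  have hN0 : (N : ℂ) ≠ 0 := NeZero.ne _
  generalize ∑ x : Kˣ, quadChar K x * (ind S₁ (2 * dlog ω N x) - ind S₂ (2 * dlog ω N x)) *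
    ψ ((ω ^ c : Kˣ) * x) = T
  -- This is G² = −Q.
  have hQG : (Fintype.card K : ℂ) / (2 * quadGaussSum ψ) = -(1 / 2) * quadGaussSum ψ := by
    field_simp
    linear_combination hG2
  have e2 : rho (Fintype.card K) * delta N a * (Fintype.card K : ℂ) / (2 * quadGaussSum ψ) =
      rho (Fintype.card K) * delta N a * (-(1 / 2) * quadGaussSum ψ) := by
    rw [mul_div_assoc, hQG]
  rw [e2]
  field_simp
  ring

end CharacterValues

section

open scoped Classical

/-! ### Fourier inversion, and strong regularity from two character values. -/

section Fourier

variable {F : Type*} [Field F] [Fintype F] {Ψ : AddChar F ℂ}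

lemma eq_zero_of_fourier_eq_zero (hΨ : Ψ.IsPrimitive) {H : F → ℂ}
    (h : ∀ β, ∑ z, H z * Ψ (β * z) = 0) (w : F) : H w = 0 := by
  have h1 : ∑ β, Ψ (-(β * w)) * ∑ z, H z * Ψ (β * z) = 0 :=
    Finset.sum_eq_zero fun β _ => by rw [h, mul_zero]
  simp_rw [Finset.mul_sum] at h1
  rw [Finset.sum_comm] at h1
  have h2 : ∀ z, ∑ β, Ψ (-(β * w)) * (H z * Ψ (β * z)) =
      H z * if z - w = 0 then (Fintype.card F : ℂ) else 0 := by
    intro z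
    have := AddChar.sum_mulShift (z - w) hΨ
    rw [← Nat.cast_zero (R := ℂ), ← Nat.cast_ite, ← this, Finset.mul_sum]
    refine Finset.sum_congr rfl fun β _ => ?_
    rw [mul_left_comm, ← AddChar.map_add_eq_mul]
    congr 2; ring
  simp_rw [h2, sub_eq_zero] at h1
  simpa using h1

/-- Every nontrivial character is a multiplicative shift of a primitive one by a unit. -/
lemma ne_one_iff_exists_zpow (hΨ : Ψ.IsPrimitive) {γ : Fˣ}
    (hγ : ∀ x : Fˣ, x ∈ Subgroup.zpowers γ) (Φ : AddChar F ℂ) :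
    Φ ≠ 1 ↔ ∃ a : ℤ, ∀ x : F, Φ x = Ψ (((γ ^ a : Fˣ) : F) * x) := by
  constructor
  · intro h
    have hbij : Function.Bijective Ψ.mulShift := by
      rw [Fintype.bijective_iff_injective_and_card]
      exact ⟨AddChar.to_mulShift_inj_of_isPrimitive hΨ, AddChar.card_eq.symm⟩
    obtain ⟨β, rfl⟩ := hbij.2 Φ
    have hβ : β ≠ 0 := by
      rintro rfl
      exact h (AddChar.mulShift_zero Ψ)
    obtain ⟨a, ha⟩ := hγ (Units.mk0 β hβ)
    refine ⟨a, fun x => ?_⟩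
    dsimp only at ha
    rw [ha]; rfl
  · rintro ⟨a, h⟩ rfl
    apply hΨ (Units.ne_zero (γ ^ a))
    ext x
    rw [AddChar.mulShift_apply, ← h]

lemma charSum_eq_charSum_smul {Φ : AddChar F ℂ} {u : Fˣ} (h : ∀ x : F, Φ x = Ψ ((u : F) * x))
    {D : Set F} (hD : (0 : F) ∉ D) : charSum Φ D = charSum Ψ (u • D) := by
  rw [charSum_smul Ψ hD, charSum_eq_sum_units Φ hD]
  simp only [h]

lemma charSum_eq_sum_ind (Φ : AddChar F ℂ) (D : Set F) : charSum Φ D = ∑ x, ind D x * Φ x := by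
  simp only [charSum, ind, Finset.sum_filter, ite_mul, one_mul, zero_mul]

/-- The autocorrelation of a set with the two nontrivial character values `r` and `r - n`. -/
lemma sum_ind_mul_ind_sub {n r : ℕ} (hΨ : Ψ.IsPrimitive) (hF : Fintype.card F = n ^ 2) {D : Set F}
    (hcard : D.ncard = r * (n + 1))
    (hval : ∀ β : F, β ≠ 0 → ∑ x, ind D x * Ψ (β * x) = r ∨
      ∑ x, ind D x * Ψ (β * x) = (r : ℂ) - n) (z : F) :
    ∑ x, ind D x * ind D (z - x) =
      (2 * r - n) * ind D z + r * (n - r) * (if z = 0 then 1 else 0) + (r ^ 2 + r) := by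
  rw [← sub_eq_zero]
  -- The values r and r − n are the roots of T² = (2r − n)T + r(n − r), which gives the first two
  -- coefficients. The constant r² + r affects only the trivial character and is fixed there by |D|
  -- = r(n + 1).
  refine eq_zero_of_fourier_eq_zero hΨ (H := fun z => ∑ x, ind D x * ind D (z - x) -
    ((2 * r - n) * ind D z + r * (n - r) * (if z = 0 then 1 else 0) + (r ^ 2 + r))) ?_ z
  intro β
  have h1 : ∑ z, (∑ x, ind D x * ind D (z - x)) * Ψ (β * z) =
      (∑ x, ind D x * Ψ (β * x)) ^ 2 := by
    simp_rw [Finset.sum_mul]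
    rw [Finset.sum_comm, sq, Finset.sum_mul]
    refine Finset.sum_congr rfl fun x _ => ?_
    rw [Finset.mul_sum]
    refine Fintype.sum_equiv (Equiv.subRight x) _ _ fun z => ?_
    rw [Equiv.subRight_apply]
    have : β * z = β * x + β * (z - x) := by ring
    rw [this, AddChar.map_add_eq_mul]; ring
  have h2 : ∑ z, (if z = 0 then (1 : ℂ) else 0) * Ψ (β * z) = 1 := by simp
  have h3 : ∑ z, ((∑ x, ind D x * ind D (z - x)) -
      ((2 * r - n) * ind D z + r * (n - r) * (if z = 0 then 1 else 0) + (r ^ 2 + r))) *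
        Ψ (β * z) = (∑ x, ind D x * Ψ (β * x)) ^ 2 -
      ((2 * r - n) * (∑ x, ind D x * Ψ (β * x)) + r * (n - r) + (r ^ 2 + r) * ∑ z, Ψ (β * z)) := by
    rw [← h1]
    simp only [sub_mul, add_mul, Finset.sum_sub_distrib, Finset.sum_add_distrib]
    simp only [← Finset.mul_sum, mul_assoc, h2]
    ring
  rw [h3]
  by_cases hβ : β = 0
  · subst hβ
    simp only [zero_mul, AddChar.map_zero_eq_one, mul_one, sum_ind, hcard]
    simp only [Finset.sum_const, Finset.card_univ, hF, nsmul_eq_mul]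
    push_cast; ring
  · rw [sum_mulShift_eq_zero hΨ hβ]
    rcases hval β hβ with h | h <;> rw [h] <;> ring

omit [Fintype F] in
lemma addCayley_adj_iff {D : Set F} (h0 : (0 : F) ∉ D) (hneg : ∀ x ∈ D, -x ∈ D) (u v : F) :
    (SimpleGraph.addCayley D).Adj u v ↔ v - u ∈ D := by
  rw [SimpleGraph.addCayley_adj']
  constructor
  · rintro ⟨-, g, hg, rfl | rfl⟩
    · simpa using hg
    · simpa using hneg g hg
  · intro h
    refine ⟨?_, v - u, h, Or.inl (by ring)⟩
    rintro rfl
    exact h0 (by simpa using h)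

/-- As D = −D, the common neighbours of v and w are counted by the autocorrelation of D at w − v,
which takes one value on D and another on nonzero elements outside D. -/
theorem isNegativeLatinSquareType_addCayley {n r : ℕ} (hΨ : Ψ.IsPrimitive)
    (hF : Fintype.card F = n ^ 2) {D : Set F} (h0 : (0 : F) ∉ D) (hneg : ∀ x ∈ D, -x ∈ D)
    (hcard : D.ncard = r * (n + 1))
    (hval : ∀ β : F, β ≠ 0 → ∑ x, ind D x * Ψ (β * x) = r ∨
      ∑ x, ind D x * Ψ (β * x) = (r : ℂ) - n)
    (hne : D.Nonempty) (hco : ∃ x ≠ 0, x ∉ D) :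
    IsNegativeLatinSquareType (SimpleGraph.addCayley D) n r := by
  have hadj := addCayley_adj_iff h0 hneg
  have hcommon : ∀ v w : F, (((SimpleGraph.addCayley D).commonNeighbors v w).ncard : ℂ) =
      (2 * r - n) * ind D (w - v) + r * (n - r) * (if w - v = 0 then 1 else 0) +
        (r ^ 2 + r) := by
    intro v w
    rw [← sum_ind_mul_ind_sub hΨ hF hcard hval, ← sum_ind]
    refine Fintype.sum_equiv (Equiv.subRight v) _ _ fun y => ?_
    have hs : w - v - (y - v) = w - y := by ring
    have hw : y - w ∈ D ↔ w - y ∈ D :=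
      ⟨fun h => by simpa using hneg _ h, fun h => by simpa using hneg _ h⟩
    rw [Equiv.subRight_apply, hs]
    simp only [ind, SimpleGraph.mem_commonNeighbors, hadj, hw]
    by_cases h1 : y - v ∈ D <;> by_cases h2 : w - y ∈ D <;> simp [h1, h2]
  obtain ⟨d, hd⟩ := hne
  have hdne : d ≠ 0 := fun h => h0 (h ▸ hd)
  have hlam : ∀ v w : F, w - v ∈ D →
      (((SimpleGraph.addCayley D).commonNeighbors v w).ncard : ℤ) = -n + r ^ 2 + 3 * r := by
    intro v w h
    have hz : w - v ≠ 0 := fun hz => h0 (hz ▸ h)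
    have := hcommon v w
    rw [ind_of_mem h, if_neg hz] at this
    have h' : (((SimpleGraph.addCayley D).commonNeighbors v w).ncard : ℂ) =
      -n + r ^ 2 + 3 * r := by rw [this]; ring
    exact_mod_cast h'
  have hreg : ∀ (v : F) [Fintype ((SimpleGraph.addCayley D).neighborSet v)],
      (SimpleGraph.addCayley D).degree v = r * (n + 1) := by
    intro v _
    rw [← hcard, ← SimpleGraph.card_neighborSet_eq_degree, Fintype.card_eq_nat_card,
      Nat.card_coe_set_eq]
    have : (SimpleGraph.addCayley D).neighborSet v = (fun x => x + v) '' D := by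
      ext y
      rw [SimpleGraph.mem_neighborSet, hadj]
      exact ⟨fun h => ⟨y - v, h, by simp⟩, by rintro ⟨x, hx, rfl⟩; simpa using hx⟩
    rw [this, Set.ncard_image_of_injective _ (add_left_injective v)]
  have hsrg : (SimpleGraph.addCayley D).IsSRGWith
      (n ^ 2) (r * (n + 1)) ((SimpleGraph.addCayley D).commonNeighbors 0 d).ncard
      (r ^ 2 + r) := by
    refine ⟨hF, fun v => hreg v, fun v w h => ?_, fun v w hvw h => ?_⟩
    · rw [Fintype.card_eq_nat_card, Nat.card_coe_set_eq]
      have h1 := hlam v w ((hadj v w).mp h)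
      have h2 := hlam 0 d (by simpa using hd)
      exact_mod_cast h1.trans h2.symm
    · rw [Fintype.card_eq_nat_card, Nat.card_coe_set_eq]
      have := hcommon v w
      rw [hadj] at h
      rw [ind_of_notMem h, if_neg (sub_ne_zero.mpr hvw.symm)] at this
      have h' : (((SimpleGraph.addCayley D).commonNeighbors v w).ncard : ℂ) =
        r ^ 2 + r := by rw [this]; ring
      exact_mod_cast h'
  refine ⟨?_, ?_, ((SimpleGraph.addCayley D).commonNeighbors 0 d).ncard,
    hlam 0 d (by simpa using hd), by convert hsrg⟩
  · intro h
    have := (hadj 0 d).mpr (by simpa using hd)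
    rw [h] at this
    exact this
  · intro h
    obtain ⟨x, hx, hxD⟩ := hco
    have : (SimpleGraph.addCayley D).Adj 0 x := by rw [h]; exact hx.symm
    rw [hadj, sub_zero] at this
    exact hxD this

end Fourier

/-! ### Symmetry and size of D, and 2 as an N-th power. -/

section ConnectionSet

variable {K L : Type*} [Field K] [Fintype K] [Field L] [Fintype L] [Algebra K L]
  {ω : Kˣ} {γ : Lˣ} {N : ℕ}

omit [Algebra K L] in
lemma neg_mem_connectionSet (hQ : Fintype.card K % 4 = 3)
    (hL : Fintype.card L = Fintype.card K ^ 2) (hω : ∀ x : Kˣ, x ∈ Subgroup.zpowers ω)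
    (hγ : ∀ x : Lˣ, x ∈ Subgroup.zpowers γ) (hN : Odd N) (hNω : N ∣ orderOf ω)
    {I₁ S₁ S₂ : Set (ZMod N)} {x : L} (hx : x ∈ connectionSet γ N I₁ S₁ S₂) :
    -x ∈ connectionSet γ N I₁ S₁ S₂ := by
  have hNγ := four_mul_dvd_orderOf hQ hL hω hγ hN hNω
  have h0 : x ≠ 0 := fun h => zero_notMem_connectionSet (h ▸ hx)
  lift x to Lˣ using IsUnit.mk0 x h0
  -- 4 divides Q + 1 and 2N divides Q − 1, so 8N divides Q² − 1 and −1 is a 4N-th power.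
  have h8 : 4 * N * 2 ∣ orderOf γ := by
    have hfac : orderOf γ = (Fintype.card K + 1) * (Fintype.card K - 1) := by
      rw [orderOf_generator hγ, hL]
      simpa using Nat.sq_sub_sq (Fintype.card K) 1
    rw [hfac, mul_assoc, mul_comm N]
    refine Nat.mul_dvd_mul (by omega) ?_
    rw [← orderOf_generator hω]
    exact two_mul_dvd_orderOf hQ hω hN hNω
  have h1 : dlog γ (4 * N) (-1) = 0 :=
    dlog_eq_zero_of_pow_eq_one hγ h8 two_ne_zero (by simp)
  rw [connectionSet, ← Units.val_neg, coe_mem_cyclotomicUnion hγ hNγ, neg_eq_neg_one_mul,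
    dlog_mul hγ hNγ, h1, zero_add]
  exact (coe_mem_cyclotomicUnion hγ hNγ).mp hx

lemma deltaMod_add_two (hN : Odd N) (j : ZMod 4) : deltaMod N (j + 2) = -deltaMod N j := by
  have h := deltaMod_sub_add_deltaMod_add hN (j + 1) 1
  have h1 : (1 : ZMod 4) ≠ 0 ∧ (1 : ZMod 4) ≠ 2 := by decide
  have h2 : j + 1 + 1 = j + 2 := by ring
  rw [add_sub_cancel_right, h2, cosMod, if_neg h1.1, if_neg h1.2] at h
  linear_combination h

lemma ncard_connectionSet [NeZero N] (hQ : Fintype.card K % 4 = 3)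
    (hL : Fintype.card L = Fintype.card K ^ 2) (hω : ∀ x : Kˣ, x ∈ Subgroup.zpowers ω)
    (hγ : ∀ x : Lˣ, x ∈ Subgroup.zpowers γ) (hγω : normUnits K γ = ω)
    (hN : Odd N) (hNω : N ∣ orderOf ω)
    {I₁ I₂ S₁ S₂ : Set (ZMod N)} (hI : Disjoint I₁ I₂) (hSunion : S₁ ∪ S₂ = I₂)
    (hSdisj : Disjoint S₁ S₂) :
    ((connectionSet γ N I₁ S₁ S₂).ncard : ℂ) =
      ((Fintype.card K : ℂ) ^ 2 - 1) / (2 * N) * (I₂.ncard + 2 * I₁.ncard) := by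
  have hNγ := four_mul_dvd_orderOf hQ hL hω hγ hN hNω
  have h4 : 4 ∣ orderOf γ := (Dvd.intro N rfl).trans hNγ
  have hN' : N ∣ orderOf γ := (Dvd.intro_left 4 rfl).trans hNγ
  have h0 := sum_units_eq (ind (connectionSet γ N I₁ S₁ S₂))
  rw [ind_of_notMem zero_notMem_connectionSet, sub_zero, sum_ind] at h0
  rw [← h0]
  simp_rw [ind_connectionSet hγ hN hNω hNγ hγω hI hSunion hSdisj]
  have hd : ∀ x : Lˣ, dlog ω N (normUnits K x) = dlog γ N x := by
    intro x
    obtain ⟨s, rfl⟩ := hγ x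
    dsimp only
    rw [dlog_normUnits hγω hNω, dlog_zpow hN']
  simp_rw [hd]
  rw [Finset.sum_add_distrib, sum_comp_dlog hγ hN' (fun j => ind I₁ j + 1 / 2 * ind I₂ j),
    Finset.sum_add_distrib, ← Finset.mul_sum, ← Finset.mul_sum, sum_ind, sum_ind]
  -- Multiplication by γ^(2N) keeps the logarithm modulo N and adds 2 modulo 4, which flips δ.
  have hz : ∑ x : Lˣ, (ind S₁ (dlog γ N x) - ind S₂ (dlog γ N x)) *
      deltaMod N (-dlog γ 4 x) = 0 := by
    rw [← self_eq_neg, ← Finset.sum_neg_distrib]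
    refine Fintype.sum_equiv (Equiv.mulRight (γ ^ ((2 * N : ℕ) : ℤ))) _ _ fun x => ?_
    have e1 : dlog γ N (x * γ ^ ((2 * N : ℕ) : ℤ)) = dlog γ N x := by
      rw [dlog_mul hγ hN', dlog_zpow hN']; simp
    have e2 : -dlog γ 4 (x * γ ^ ((2 * N : ℕ) : ℤ)) = -dlog γ 4 x + 2 := by
      rw [dlog_mul hγ h4, dlog_zpow h4]
      obtain ⟨k, rfl⟩ := hN
      have h4 : (4 : ZMod 4) = 0 := by decide
      push_cast
      linear_combination (-(k : ZMod 4) - 1) * h4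
    rw [Equiv.coe_mulRight, e1, e2, deltaMod_add_two hN]
    ring
  rw [hz, Fintype.card_units, Nat.cast_sub Fintype.card_pos, hL]
  have hN0 : (N : ℂ) ≠ 0 := NeZero.ne _
  push_cast
  field_simp
  ring

omit [Fintype L] in
lemma zpow_mem_connectionSet (hγ : ∀ x : Lˣ, x ∈ Subgroup.zpowers γ) (hN : Odd N)
    (hNγ : 4 * N ∣ orderOf γ) {I₁ S₁ S₂ : Set (ZMod N)} (s : ℤ) :
    ((γ ^ s : Lˣ) : L) ∈ connectionSet γ N I₁ S₁ S₂ ↔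
      ((s : ZMod N) ∈ S₁ ∧ deltaMod N (-(s : ZMod 4)) = 1) ∨
      ((s : ZMod N) ∈ S₂ ∧ deltaMod N (-(s : ZMod 4)) = -1) ∨ (s : ZMod N) ∈ I₁ := by
  rw [connectionSet, coe_mem_cyclotomicUnion hγ hNγ, dlog_zpow hNγ, intCast_mem_indexY hN]

end ConnectionSet

/-- In characteristic `p`, the element `2` is an `N`-th power whenever `N` divides
`(q ^ m - 1) / (q - 1)`. -/
lemma dlog_two {p q m N : ℕ} [Fact p.Prime] {K : Type*} [Field K] [Fintype K]
    [Algebra (ZMod p) K] (hK : Fintype.card K = q ^ m) (hq : q ^ m % 4 = 3)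
    (hNdvd : N ∣ (q ^ m - 1) / (q - 1)) {ω : Kˣ} (hω : ∀ x : Kˣ, x ∈ Subgroup.zpowers ω)
    {t : Kˣ} (ht : (t : K) = 2) : dlog ω N t = 0 := by
  have hm : m ≠ 0 := by rintro rfl; norm_num at hq
  have hq0 : q ≠ 0 := by rintro rfl; rw [zero_pow hm] at hq; norm_num at hq
  have hq1 : q ≠ 1 := by rintro rfl; rw [one_pow] at hq; norm_num at hq
  have : CharP K p := charP_of_injective_algebraMap (algebraMap (ZMod p) K).injective p
  obtain ⟨n, -, hn⟩ := FiniteField.card K p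
  -- Thus q is a power of p, and 2, lying in the prime field, is fixed by x ↦ x^q.
  have hqp : q ∣ p ^ (n : ℕ) := by rw [← hn, hK]; exact dvd_pow_self q hm
  obtain ⟨j, -, hj⟩ := (Nat.dvd_prime_pow Fact.out).mp hqp
  have h2 : (2 : K) ^ q = 2 := by
    have := congrArg (algebraMap (ZMod p) K) (ZMod.pow_card_pow (n := j) (2 : ZMod p))
    rwa [map_pow, map_ofNat, ← hj] at this
  have ht' : t ^ (q - 1) = 1 := by
    have : t ^ (q - 1) * t = 1 * t := by
      rw [← pow_succ, Nat.sub_add_cancel (Nat.one_le_iff_ne_zero.mpr hq0), one_mul]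
      ext; rw [Units.val_pow_eq_pow_val, ht, h2]
    exact mul_right_cancel this
  refine dlog_eq_zero_of_pow_eq_one hω (k := q - 1) ?_ (by omega) ht'
  rw [orderOf_generator hω, hK]
  have hdiv : q - 1 ∣ q ^ m - 1 := by simpa using Nat.sub_dvd_pow_sub_pow q 1 m
  calc N * (q - 1) ∣ (q ^ m - 1) / (q - 1) * (q - 1) := Nat.mul_dvd_mul_right hNdvd _
    _ = q ^ m - 1 := Nat.div_mul_cancel hdiv

end

/-! ### Signs and congruences for the final assembly. -/

section CharacterValueSet

lemma rho_mul_delta (Q N : ℕ) (a : ℤ) : rho Q * delta N a = 1 ∨ rho Q * delta N a = -1 := by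
  rw [rho, delta]
  split_ifs <;> simp

lemma exists_four_mul_modEq {N : ℕ} (hN : Odd N) (a : ℤ) : ∃ b : ℤ, 4 * b ≡ a [ZMOD N] := by
  have h : ((4 : ℕ) : ZMod N) * ((4 : ℕ) : ZMod N)⁻¹ = 1 :=
    ZMod.coe_mul_inv_eq_one 4 ((hN.coprime_two_left).pow_left 2)
  obtain ⟨b, hb⟩ := ZMod.intCast_surjective (((4 : ℕ) : ZMod N)⁻¹ * (a : ZMod N))
  refine ⟨b, (ZMod.intCast_eq_intCast_iff _ _ _).mp ?_⟩
  push_cast at h ⊢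
  rw [hb, Nat.cast_ofNat]
  linear_combination (a : ZMod N) * h

lemma even_and_two_mul_of_modEq {N : ℕ} {a b c : ℤ} (hb : 4 * b ≡ a [ZMOD N])
    (hc : c ≡ 2 * b [ZMOD (2 * N : ℕ)]) : Even c ∧ (2 * c : ZMod N) = a := by
  have h1 := (ZMod.intCast_eq_intCast_iff _ _ _).mpr hc
  have h2 := (ZMod.intCast_eq_intCast_iff _ _ _).mpr hb
  have h3 := intCast_eq_of_modEq (Dvd.intro N rfl) h1
  have h4 := intCast_eq_of_modEq (Dvd.intro_left 2 rfl) h1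
  rw [ZMod.intCast_eq_intCast_iff_dvd_sub] at h3
  refine ⟨?_, ?_⟩
  · have h5 : Even (2 * b - c) := even_iff_two_dvd.mpr (by exact_mod_cast h3)
    rw [Int.even_sub] at h5
    exact h5.mp (even_two_mul b)
  · push_cast at h2 h4
    rw [h4, ← h2]; ring

end CharacterValueSet

end ThreeValuedPeriods

end

/-! ### Assembly of the theorem. -/

open ThreeValuedPeriods in
theorem mainTheorem2
    {p q m N : ℕ} [Fact p.Prime]
    {K L : Type*} [Field K] [Fintype K] [Field L] [Fintype L]
    [Algebra (ZMod p) K] [Algebra (ZMod p) L] [Algebra K L]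
    (hK : Fintype.card K = q ^ m) (hL : Fintype.card L = q ^ (2 * m))
    (hq : q ^ m % 4 = 3) (hN : Odd N) (hNdvd : N ∣ (q ^ m - 1) / (q - 1))
    (ω : Kˣ) (hω : ∀ x : Kˣ, x ∈ Subgroup.zpowers ω)
    (γ : Lˣ) (hγ : ∀ x : Lˣ, x ∈ Subgroup.zpowers γ)
    (hγω : (γ : L) ^ (q ^ m + 1) = algebraMap K L (ω : K))
    (ψ : AddChar K ℂ) (hψ : ψ = ThreeValuedPeriods.canonicalChar p K)
    (Ψ : AddChar L ℂ) (hΨ : Ψ = ThreeValuedPeriods.canonicalChar p L)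
    (α₁ α₂ α₃ : ℚ)
    (hα : Set.range (ThreeValuedPeriods.gaussPeriod ψ ω N) = {(α₁ : ℂ), (α₂ : ℂ), (α₃ : ℂ)})
    (hAP : α₁ - α₂ = α₂ - α₃) (hpos : 0 < α₁ - α₂)
    (I₁ I₂ I₃ : Set (ZMod N))
    (hI₁ : I₁ = ThreeValuedPeriods.periodSet ψ ω N α₁)
    (hI₂ : I₂ = ThreeValuedPeriods.periodSet ψ ω N α₂)
    (hI₃ : I₃ = ThreeValuedPeriods.periodSet ψ ω N α₃)
    (S₁ S₂ : Set (ZMod N)) (hSunion : S₁ ∪ S₂ = I₂) (hSdisj : Disjoint S₁ S₂)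
    (D : Set L) (hD : D = ThreeValuedPeriods.connectionSet γ N I₁ S₁ S₂) :
    -- `D` is an inverse-closed set of nonzero elements
    ((0 : L) ∉ D ∧ ∀ x ∈ D, -x ∈ D) ∧
    -- the nontrivial characters of `L` are the characters `x ↦ Ψ (γ ^ a x)`
    (∀ Φ : AddChar L ℂ, Φ ≠ 1 ↔ ∃ a : ℤ, ∀ x : L, Φ x = Ψ (((γ ^ a : Lˣ) : L) * x)) ∧
    -- the nontrivial character values of `D`
    (∀ a b c : ℤ, 4 * b ≡ a [ZMOD N] → c ≡ 2 * b [ZMOD (2 * N : ℕ)] →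
      ∃ shift : ℂ,
        (((a : ZMod N) ∈ I₁ ∧ shift = -(q : ℂ) ^ m) ∨
         ((a : ZMod N) ∈ I₂ ∧ shift = -((q : ℂ) ^ m / 2)) ∨
         ((a : ZMod N) ∈ I₃ ∧ shift = 0)) ∧
        ThreeValuedPeriods.charSum Ψ (γ ^ a • D) =
          ThreeValuedPeriods.rho (q ^ m) * ThreeValuedPeriods.delta N a * (q : ℂ) ^ m /
              (2 * ThreeValuedPeriods.quadGaussSum ψ) *
            ThreeValuedPeriods.bracket ψ ω N I₂ S₁ S₂ c +
          ((q : ℂ) ^ m - 1) * (2 * (I₁.ncard : ℂ) + (I₂.ncard : ℂ)) / (2 * (N : ℂ)) +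
          shift) ∧
    -- the strongly regular case
    ((∀ c : ℤ, Even c →
        (((c : ZMod N) ∈ ThreeValuedPeriods.halve I₂ →
            ThreeValuedPeriods.bracket ψ ω N I₂ S₁ S₂ c = ThreeValuedPeriods.quadGaussSum ψ ∨
            ThreeValuedPeriods.bracket ψ ω N I₂ S₁ S₂ c = -ThreeValuedPeriods.quadGaussSum ψ) ∧
         ((c : ZMod N) ∉ ThreeValuedPeriods.halve I₂ →
            ThreeValuedPeriods.bracket ψ ω N I₂ S₁ S₂ c = 0))) →
      ∃ r : ℕ, 2 * N * r = (I₂.ncard + 2 * I₁.ncard) * (q ^ m - 1) ∧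
        {z : ℂ | ∃ Φ : AddChar L ℂ, Φ ≠ 1 ∧ z = ThreeValuedPeriods.charSum Φ D} =
          {(r : ℂ), (r : ℂ) - (q : ℂ) ^ m} ∧
        ThreeValuedPeriods.IsNegativeLatinSquareType (SimpleGraph.addCayley D) (q ^ m) r) := by
  have hm : m ≠ 0 := by rintro rfl; norm_num at hq
  have hQ : Fintype.card K % 4 = 3 := by rw [hK, hq]
  have hL' : Fintype.card L = Fintype.card K ^ 2 := by rw [hL, hK, ← pow_mul, mul_comm]
  have hKC : (q : ℂ) ^ m = Fintype.card K := by rw [hK]; push_cast; rfl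
  have hNeZero : NeZero N := ⟨by rintro rfl; simp at hN⟩
  have hψp : ψ.IsPrimitive := hψ ▸ canonicalChar_isPrimitive K
  have hΨp : Ψ.IsPrimitive := hΨ ▸ canonicalChar_isPrimitive L
  have hΨψ : ∀ x, Ψ x = ψ (Algebra.trace K L x) := by
    rw [hΨ, hψ]; exact canonicalChar_eq_trace
  have hν : normUnits K γ = ω := by
    ext
    apply (algebraMap K L).injective
    rw [coe_normUnits, norm_eq_pow hL', hK, hγω]
  have hNω : N ∣ orderOf ω := by
    rw [orderOf_generator hω, hK]
    exact hNdvd.trans (Nat.div_dvd_of_dvd (by simpa using Nat.sub_dvd_pow_sub_pow q 1 m))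
  have hNγ := four_mul_dvd_orderOf hQ hL' hω hγ hN hNω
  obtain ⟨t, ht⟩ : ∃ t : Kˣ, (t : K) = 2 := ⟨Units.mk0 2 (two_ne_zero_of_card hQ), rfl⟩
  have htwo : dlog ω N t = 0 := dlog_two (p := p) hK hq hNdvd hω ht
  have hd0 : (α₁ : ℂ) - α₂ ≠ 0 := by exact_mod_cast hpos.ne'
  have hAPC : (α₁ : ℂ) - α₂ = α₂ - α₃ := by exact_mod_cast hAP
  rw [periodSet_eq hω hNω] at hI₁ hI₂ hI₃
  have m1 : ∀ j, j ∈ I₁ ↔ period ψ ω N j = α₁ := fun j => by rw [hI₁]; rfl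
  have m2 : ∀ j, j ∈ I₂ ↔ period ψ ω N j = α₂ := fun j => by rw [hI₂]; rfl
  have m3 : ∀ j, j ∈ I₃ ↔ period ψ ω N j = α₃ := fun j => by rw [hI₃]; rfl
  have h12 : Disjoint I₁ I₂ := Set.disjoint_left.mpr fun j h1 h2 =>
    hd0 (by rw [← (m1 j).mp h1, ← (m2 j).mp h2, sub_self])
  have h13 : ∀ j, j ∈ I₃ → j ∉ I₁ := fun j h3 h1 => by
    rw [m3] at h3; rw [m1, h3] at h1
    apply hd0; linear_combination (-1 / 2 : ℂ) * h1 + (1 / 2 : ℂ) * hAPC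
  have h23 : ∀ j, j ∈ I₃ → j ∉ I₂ := fun j h3 h2 => by
    rw [m3] at h3; rw [m2, h3] at h2
    apply hd0; linear_combination hAPC - h2
  have hcover : ∀ j, j ∈ I₁ ∨ j ∈ I₂ ∨ j ∈ I₃ := by
    intro j
    obtain ⟨i, rfl⟩ := ZMod.intCast_surjective j
    have : gaussPeriod ψ ω N i ∈ Set.range (gaussPeriod ψ ω N) := ⟨i, rfl⟩
    rw [hα, gaussPeriod_eq hω hNω] at this
    rw [m1, m2, m3]; exact this
  have hex1 : ∃ a : ℤ, (a : ZMod N) ∈ I₁ := by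
    have : (α₁ : ℂ) ∈ Set.range (gaussPeriod ψ ω N) := by rw [hα]; simp
    obtain ⟨a, ha⟩ := this
    exact ⟨a, by rw [m1, ← gaussPeriod_eq hω hNω, ha]⟩
  have hex3 : ∃ a : ℤ, (a : ZMod N) ∈ I₃ := by
    have : (α₃ : ℂ) ∈ Set.range (gaussPeriod ψ ω N) := by rw [hα]; simp
    obtain ⟨a, ha⟩ := this
    exact ⟨a, by rw [m3, ← gaussPeriod_eq hω hNω, ha]⟩
  -- The affine function with values 1, ½, 0 at α₁, α₂, α₃; it exists because of the arithmetic
  -- progression.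
  have hf : ∀ j, ind I₁ j + 1 / 2 * ind I₂ j =
      (1 / 2 - α₂ / (2 * (α₁ - α₂))) + 1 / (2 * (α₁ - α₂)) * period ψ ω N j := by
    intro j
    rcases hcover j with h | h | h
    · rw [ind_of_mem h, ind_of_notMem (Set.disjoint_left.mp h12 h), (m1 j).mp h]
      field_simp; ring
    · rw [ind_of_mem h, ind_of_notMem (Set.disjoint_right.mp h12 h), (m2 j).mp h]
      field_simp; ring
    · rw [ind_of_notMem (h13 j h), ind_of_notMem (h23 j h), (m3 j).mp h]
      have : (α₃ : ℂ) = 2 * α₂ - α₁ := by linear_combination hAPC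
      rw [this]
      field_simp; ring
  have hvalue : ∀ a c : ℤ, Even c → (2 * c : ZMod N) = a → _ := fun a c hc hca =>
    charSum_smul_connectionSet hQ hL' hψp hΨψ hΨp hω hγ hν hN hNω t ht htwo h12 hSunion hSdisj hf
      hc hca
  have h0 : (0 : L) ∉ D := by rw [hD]; exact zero_notMem_connectionSet
  have hneg : ∀ x ∈ D, -x ∈ D := by
    rw [hD]; exact fun x hx => neg_mem_connectionSet hQ hL' hω hγ hN hNω hx
  have hchar := ne_one_iff_exists_zpow hΨp hγ
  refine ⟨⟨h0, hneg⟩, hchar, ?_, ?_⟩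
  · intro a b c hb hc
    obtain ⟨hc2, hca⟩ := even_and_two_mul_of_modEq hb hc
    have hv := hvalue a c hc2 hca
    rw [← hD] at hv
    refine ⟨-(Fintype.card K * (ind I₁ (a : ZMod N) + 1 / 2 * ind I₂ (a : ZMod N))), ?_, ?_⟩
    · rw [hKC]
      rcases hcover a with h | h | h
      · left
        rw [ind_of_mem h, ind_of_notMem (Set.disjoint_left.mp h12 h)]
        exact ⟨h, by ring⟩
      · right; left
        rw [ind_of_mem h, ind_of_notMem (Set.disjoint_right.mp h12 h)]
        exact ⟨h, by ring⟩
      · right; right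
        rw [ind_of_notMem (h13 _ h), ind_of_notMem (h23 _ h)]
        exact ⟨h, by ring⟩
    · rw [hv, hKC, hK]; ring
  · intro hbr
    obtain ⟨M, hM⟩ := two_mul_dvd_orderOf hQ hω hN hNω
    rw [orderOf_generator hω, hK] at hM
    have hq1 : 1 ≤ q ^ m := by omega
    -- Here M = (Q − 1)/(2N), an integer since 2N divides Q − 1.
    set r : ℕ := M * (I₂.ncard + 2 * I₁.ncard) with hr
    have hN0 : (N : ℂ) ≠ 0 := NeZero.ne _
    have hMC : (Fintype.card K : ℂ) - 1 = 2 * N * M := by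
      rw [hK, ← Nat.cast_one, ← Nat.cast_sub hq1, hM]; push_cast; ring
    have hrC : ((Fintype.card K : ℂ) - 1) * (2 * (I₁.ncard : ℂ) + (I₂.ncard : ℂ)) /
        (2 * (N : ℂ)) = r := by
      rw [hMC, hr]; push_cast; field_simp; ring
    have hG := quadGaussSum_ne_zero hQ hψp
    have hvals : ∀ a : ℤ, ((a : ZMod N) ∈ I₁ → charSum Ψ (γ ^ a • D) = (r : ℂ) - q ^ m) ∧
        ((a : ZMod N) ∈ I₃ → charSum Ψ (γ ^ a • D) = r) ∧
        (charSum Ψ (γ ^ a • D) = r ∨ charSum Ψ (γ ^ a • D) = (r : ℂ) - q ^ m) := by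
      intro a
      obtain ⟨b, hb⟩ := exists_four_mul_modEq hN a
      obtain ⟨hc, hca⟩ := even_and_two_mul_of_modEq hb (c := 2 * b) rfl
      have hv := hvalue a (2 * b) hc hca
      rw [← hD, hrC] at hv
      obtain ⟨hb1, hb2⟩ := hbr (2 * b) hc
      rw [mem_halve hN, hca] at hb1 hb2
      rw [hKC]
      have v1 : (a : ZMod N) ∈ I₁ → charSum Ψ (γ ^ a • D) = (r : ℂ) - Fintype.card K := by
        intro h
        rw [hv, hb2 (Set.disjoint_left.mp h12 h), ind_of_mem h,
          ind_of_notMem (Set.disjoint_left.mp h12 h)]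
        ring
      have v3 : (a : ZMod N) ∈ I₃ → charSum Ψ (γ ^ a • D) = r := by
        intro h
        rw [hv, hb2 (h23 _ h), ind_of_notMem (h13 _ h), ind_of_notMem (h23 _ h)]
        ring
      refine ⟨v1, v3, ?_⟩
      rcases hcover a with h | h | h
      · exact Or.inr (v1 h)
      · rw [hv, ind_of_mem h, ind_of_notMem (Set.disjoint_right.mp h12 h)]
        -- On I₂ the bracket term is ±Q/2 and ε_a is −Q/2, so the total is r or r − Q.
        rcases hb1 h with e | e <;> rcases rho_mul_delta (Fintype.card K) N a with e' | e' <;>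
          rw [e, e']
        · left; field_simp; ring
        · right; field_simp; ring
        · right; field_simp; ring
        · left; field_simp; ring
      · exact Or.inl (v3 h)
    refine ⟨r, by rw [hM, hr]; ring, ?_, ?_⟩
    · ext z
      simp only [Set.mem_ofPred_eq, Set.mem_insert_iff, Set.mem_singleton_iff]
      constructor
      · rintro ⟨Φ, hΦ, rfl⟩
        obtain ⟨a, ha⟩ := (hchar Φ).mp hΦ
        rw [charSum_eq_charSum_smul ha h0]
        exact (hvals a).2.2
      · have hΦ : ∀ a : ℤ, ∃ Φ : AddChar L ℂ, Φ ≠ 1 ∧ charSum Ψ (γ ^ a • D) = charSum Φ D :=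
          fun a => ⟨Ψ.mulShift ((γ ^ a : Lˣ) : L), (hchar _).mpr ⟨a, fun x => rfl⟩,
            (charSum_eq_charSum_smul (fun x => rfl) h0).symm⟩
        -- Both values occur: r on I₃ and r − Q on I₁, which are nonempty as α₃ and α₁ are attained.
        rintro (rfl | rfl)
        · obtain ⟨a, ha⟩ := hex3
          rw [← (hvals a).2.1 ha]
          exact hΦ a
        · obtain ⟨a, ha⟩ := hex1
          rw [← (hvals a).1 ha]
          exact hΦ a
    · have hcard : D.ncard = r * (q ^ m + 1) := by
        have h := ncard_connectionSet hQ hL' hω hγ hν hN hNω h12 hSunion hSdisj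
        rw [← hD] at h
        have h' : (D.ncard : ℂ) = r * (q ^ m + 1) := by
          rw [h, hKC, ← hrC]; field_simp; ring
        exact_mod_cast h'
      refine isNegativeLatinSquareType_addCayley hΨp (by rw [hL', hK]) h0 hneg hcard ?_ ?_ ?_
      · intro β hβ
        obtain ⟨a, ha⟩ := hγ (Units.mk0 β hβ)
        have ha' : ((γ ^ a : Lˣ) : L) = β := by dsimp only at ha; rw [ha]; rfl
        have h1 : charSum Ψ (γ ^ a • D) = ∑ x, ind D x * Ψ (β * x) := by
          rw [← charSum_eq_charSum_smul (Φ := Ψ.mulShift β) (fun x => by rw [ha']; rfl) h0,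
            charSum_eq_sum_ind]
          rfl
        rw [← h1]
        push_cast
        exact (hvals a).2.2
      -- Classes over I₁ lie in D, so the graph has edges; those over I₃ avoid D, so it is not
      -- complete.
      · obtain ⟨a, ha⟩ := hex1
        refine ⟨((γ ^ a : Lˣ) : L), ?_⟩
        rw [hD, zpow_mem_connectionSet hγ hN hNγ]
        exact Or.inr (Or.inr ha)
      · obtain ⟨a, ha⟩ := hex3
        refine ⟨((γ ^ a : Lˣ) : L), Units.ne_zero _, ?_⟩
        rw [hD, zpow_mem_connectionSet hγ hN hNγ]
        have := h23 _ ha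
        rw [← hSunion] at this
        rintro (h | h | h)
        · exact this (Or.inl h.1)
        · exact this (Or.inr h.1)
        · exact h13 _ ha h
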